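/- Let $r\ge 1$ and let $\mathbb T^r=(\mathbb R/\mathbb Z)^r$ carry Lebesgue measure; functions on $[0,1]^r$ are evaluated on $\mathbb T^r$ through the representatives in $[0,1)^r$. For $\alpha\in\mathbb R^r$ let $T_\alpha x=x+\alpha \bmod 1$. For $t\in\mathbb R$ let $\|t\|$ be the distance from $t$ to the nearest integer, and for $h\in\mathbb Z^r$ put $r(h)=\prod_{i=1}^r\max(1,|h_i|)$. Call $\sigma\in\mathbb R$ admissible for $\alpha$ if there is $c>0$ with $r(h)^{\sigma}\,\|\langle h,\alpha\rangle\|\ge c$ for all $h\in\mathbb Z^r\setminus\{0\}$. A vector $\alpha$ with irrational coordinates is of type $\eta\in\mathbb R$ if $\eta$ is the infimum of its admissible exponents (then $\eta\ge 1$). For $g:[0,1]^p\to\mathbb R$ the Vitali variation is the supremum, over all grids formed by finite sequences $0=\eta^{(j)}_0\le\dots\le\eta^{(j)}_{m_j}=1$ ($1\le j\le p$), of the sum over the cells of the grid of the absolute value of the $p$-fold mixed difference of $g$ over the cell. A function $f:[0,1]^r\to\mathbb R$ is of bounded variation in the sense of Hardy and Krause if, for every nonempty $u\subseteq\{1,\dots,r\}$,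 the restriction of $f$ to the face $\{t\in[0,1]^r: t_j=1 \text{ for } j\notin u\}$, as a function of the coordinates in $u$, has finite Vitali variation. **Proposition.** Let $f:[0,1]^r\to\mathbb R$ be of bounded variation in the sense of Hardy and Krause and let $\alpha$ be an irrational vector of type $\eta$. Then $f$ is integrable, and $$S_n=\sup_{x\in\mathbb T^r}\Big|\sum_{l=1}^n\Big(f(T_\alpha^l x)-\int_{\mathbb T^r}f(t)\,dt\Big)\Big|$$ is finite for every $n$. As $n\to\infty$: 1. If the infimum defining the type is attained, that is, if $r(h)^{\eta}\,\|\langle h,\alpha\rangle\|\ge c$ for some $c>0$ and all $h\in\mathbb Z^r\setminus\{0\}$, then $S_n=O(\log^{r+1}n)$ if $\eta=1$, and $S_n=O\big(n^{1-\frac1{(\eta-1)r+1}}\log n\big)$ if $\eta>1$. 2. Whether or not it is attained, $S_n=O\big(n^{1-\frac1{(\eta'-1)r+1}}\log n\big)$ for every $\eta'>\eta$. -/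

import Mathlib

open Filter MeasureTheory
open scoped ENNReal

noncomputable section

namespace TorusRotation

/-- A partition of the unit cube `[0,1]^ι`: for every coordinate `j` a finite sequence
`0 = η₀ ≤ η₁ ≤ … ≤ η_{m_j} = 1`. -/
structure CubePartition (ι : Type*) where
  /-- The number `m_j` of steps in direction `j`. -/
  size : ι → ℕ
  /-- The points `η₀, …, η_{m_j}` in direction `j`. -/
  pt : ∀ j, Fin (size j + 1) → ℝ
  mono : ∀ j, Monotone (pt j)
  pt_zero : ∀ j, pt j 0 = 0
  pt_last : ∀ j, pt j (Fin.last (size j)) = 1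

/-- The iterated difference `Δ_{1,…,p} g` of `g` over the box with lower corner `a` and upper
corner `b`, written out as the alternating sum of `g` over the `2^p` vertices of the box. -/
def mixedDifference {ι : Type*} [Fintype ι] [DecidableEq ι]
    (g : (ι → ℝ) → ℝ) (a b : ι → ℝ) : ℝ :=
  ∑ S : Finset ι, (-1 : ℝ) ^ (Sᶜ.card) * g (fun i => if i ∈ S then b i else a i)

/-- The variation of `g` on `[0,1]^ι` in the sense of Vitali: the supremum over all partitions
of the sum of the absolute values of the iterated differences over the cells. -/
def vitaliVariation {ι : Type*} [Fintype ι] [DecidableEq ι] (g : (ι → ℝ) → ℝ) : ℝ≥0∞ :=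
  ⨆ P : CubePartition ι, ∑ k : (∀ j, Fin (P.size j)),
    ENNReal.ofReal |mixedDifference g
      (fun j => P.pt j (k j).castSucc) (fun j => P.pt j (k j).succ)|

/-- The restriction of `f` to the face of `[0,1]^r` on which all the coordinates outside `u` are
equal to `1`, as a function of the coordinates in `u`. -/
def faceRestriction {r : ℕ} (f : (Fin r → ℝ) → ℝ) (u : Finset (Fin r)) : (u → ℝ) → ℝ :=
  fun t => f (fun i => if h : i ∈ u then t ⟨i, h⟩ else 1)

/-- `f` is of bounded variation on `[0,1]^r` in the sense of Hardy and Krause. Only the values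
of `f` on `[0,1]^r` matter. -/
def IsBVHardyKrause {r : ℕ} (f : (Fin r → ℝ) → ℝ) : Prop :=
  ∀ u : Finset (Fin r), u.Nonempty → vitaliVariation (faceRestriction f u) < ∞

/-- `‖t‖`, the distance of the real number `t` to the nearest integer. -/
def distInt (t : ℝ) : ℝ := |t - round t|

/-- `r(h) = ∏ᵢ max (1, |hᵢ|)`. -/
def weight {r : ℕ} (h : Fin r → ℤ) : ℝ := ∏ i, max 1 |(h i : ℝ)|

/-- There is `c > 0` with `r(h)^σ ‖⟨h, α⟩‖ ≥ c` for all nonzero integer vectors `h`. -/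
def DiophantineWith {r : ℕ} (α : Fin r → ℝ) (σ : ℝ) : Prop :=
  ∃ c : ℝ, 0 < c ∧ ∀ h : Fin r → ℤ, h ≠ 0 →
    c ≤ weight h ^ σ * distInt (∑ i, (h i : ℝ) * α i)

/-- `α` is an irrational vector of type `η`: its coordinates are irrational, and `η` is the
infimum of the exponents `σ` with `DiophantineWith α σ`. (There is no such real `η` when no
exponent is admissible.) -/
def IsOfType {r : ℕ} (α : Fin r → ℝ) (η : ℝ) : Prop :=
  (∀ i, Irrational (α i)) ∧ IsGLB {σ : ℝ | DiophantineWith α σ} η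

/-- The rotation `T_α : x ↦ x + α mod 1` of the torus `𝕋^r = (ℝ/ℤ)^r`. -/
def rotation {r : ℕ} (α : Fin r → ℝ) (x : UnitAddTorus (Fin r)) : UnitAddTorus (Fin r) :=
  fun i => x i + (α i : UnitAddCircle)

/-- A function on `[0,1]^r` as a function on the torus: a point of the torus is identified with
its representative in `[0,1)^r`. -/
def onTorus {r : ℕ} (f : (Fin r → ℝ) → ℝ) (x : UnitAddTorus (Fin r)) : ℝ :=
  f (fun i => (AddCircle.equivIco (1 : ℝ) 0 (x i) : ℝ))

/-- `∑_{l=1}^n (f(T_α^l x) - ∫ f)`. -/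
def birkhoffDeviation {r : ℕ} (f : (Fin r → ℝ) → ℝ) (α : Fin r → ℝ) (n : ℕ)
    (x : UnitAddTorus (Fin r)) : ℝ :=
  ∑ l ∈ Finset.Icc 1 n,
    (onTorus f ((rotation α)^[l] x) - ∫ t : UnitAddTorus (Fin r), onTorus f t)

/-- `sup_x |∑_{l=1}^n (f(T_α^l x) - ∫ f)|`. -/
def supDeviation {r : ℕ} (f : (Fin r → ℝ) → ℝ) (α : Fin r → ℝ) (n : ℕ) : ℝ :=
  ⨆ x : UnitAddTorus (Fin r), |birkhoffDeviation f α n x|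

end TorusRotation

end

/-! The proof bounds the Birkhoff deviation by (Hardy–Krause variation) × (box discrepancy of
orbits) and estimates the discrepancy by a sum of small divisors.

Koksma–Hlawka is used only for finitely many weighted points whose weights sum to zero
(`abs_sum_mul_le_hardyKrauseVariation`). Inclusion–exclusion over the faces through (1,…,1) writes f
as a signed sum of mixed differences with upper corner 1, and each of these is a sum of cell
differences over a grid containing all the points; exchanging sums pairs the variation with counts
of points in boxes. The integral enters by comparing n points of the orbit of x with M points of the
orbit of y, weighted by −n/M, then integrating over y and letting M → ∞
(`abs_birkhoffDeviation_le`). The same decomposition makes f almost everywhere measurable, since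
each mixed difference is a difference of functions antitone in the point.

The discrepancy estimate is an Erdős–Turán–Koksma inequality (`abs_boxDeviation_le_expSumBound`).
Averaging a box over random translations distributed by a product of Fejér kernels truncates its
Fourier series at frequency H; large translations are improbable, and their effect is absorbed into
the supremum over all boxes. Geometric summation then bounds the discrepancy by a multiple of Σ
1/(r(h)‖⟨h,α⟩‖) + n/H.

For the small divisors (`exists_smallDivisorSum_le`), group h into dyadic blocks. Within a block,
differences of frequencies have weight comparable to 2^s, where s is the total binary length, so the
numbers ⟨h,α⟩ are separated modulo 1 by about 2^(−sσ), and their reciprocals add up to at most a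
harmonic sum. A block contributes about 2^(s(σ−1)) times a logarithm. Summing over blocks gives
log^(r+1) H for σ = 1 and H^((σ−1)r) log H for σ > 1; the choices H = n and H ≈ n^(1/((σ−1)r+1))
give the rates. -/

noncomputable section

namespace TorusRotation

/-! ### Mixed differences, grids and summation by parts -/

section MixedDifference

variable {ι : Type*} [Fintype ι]

/-- The indicator of the box of all points strictly below `t`. -/
def below (p t : ι → ℝ) : ℝ := ∏ j, if p j < t j then 1 else 0

lemma below_nonneg (p t : ι → ℝ) : 0 ≤ below p t :=
  Finset.prod_nonneg fun j _ => by split_ifs <;> norm_num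

lemma below_le_one (p t : ι → ℝ) : below p t ≤ 1 :=
  Finset.prod_le_one (fun j _ => by split_ifs <;> norm_num) fun j _ => by split_ifs <;> norm_num

lemma below_anti (t : ι → ℝ) {p q : ι → ℝ} (h : p ≤ q) : below q t ≤ below p t := by
  refine Finset.prod_le_prod (fun j _ => by split_ifs <;> norm_num) fun j _ => ?_
  by_cases hq : q j < t j
  · rw [if_pos hq, if_pos ((h j).trans_lt hq)]
  · rw [if_neg hq]
    split_ifs <;> norm_num

variable [DecidableEq ι]

/-- The multilinear form on functions on the line whose value at Dirac masses is `g`, as far as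
these sit at points of the finite set `A`. -/
def gridForm (g : (ι → ℝ) → ℝ) (A : Finset ℝ) : MultilinearMap ℝ (fun _ : ι => ℝ → ℝ) ℝ :=
  ∑ y ∈ Fintype.piFinset (fun _ : ι => A),
    g y • (MultilinearMap.mkPiAlgebra ℝ ι ℝ).compLinearMap (fun j => LinearMap.proj (y j))

lemma gridForm_apply (g : (ι → ℝ) → ℝ) (A : Finset ℝ) (v : ι → ℝ → ℝ) :
    gridForm g A v = ∑ y ∈ Fintype.piFinset (fun _ : ι => A), g y * ∏ j, v j (y j) := by
  simp [gridForm]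

lemma gridForm_single (g : (ι → ℝ) → ℝ) (A : Finset ℝ) (x : ι → ℝ) (hx : ∀ j, x j ∈ A) :
    gridForm g A (fun j => Pi.single (x j) 1) = g x := by
  rw [gridForm_apply, Finset.sum_eq_single x]
  · simp
  · intro y _ hyx
    obtain ⟨j, hj⟩ := Function.ne_iff.1 hyx
    rw [Finset.prod_eq_zero (Finset.mem_univ j), mul_zero]
    simp [hj]
  · intro h
    exact absurd (Fintype.mem_piFinset.2 hx) h

/-- Multilinear expansion of the product of the differences δ_b − δ_a of Dirac masses, one factor
per coordinate, produces the alternating sum over vertices. -/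
lemma mixedDifference_eq_gridForm (g : (ι → ℝ) → ℝ) (A : Finset ℝ) (a b : ι → ℝ)
    (ha : ∀ j, a j ∈ A) (hb : ∀ j, b j ∈ A) :
    mixedDifference g a b =
      gridForm g A (fun j => Pi.single (b j) 1 - Pi.single (a j) 1) := by
  have h : (fun j => Pi.single (b j) 1 - Pi.single (a j) 1 : ι → ℝ → ℝ) =
      (fun j => Pi.single (b j) 1) + (fun j => (-1 : ℝ) • Pi.single (a j) 1) := by
    ext j t
    simp [sub_eq_add_neg]
  rw [h, MultilinearMap.map_add_univ, mixedDifference]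
  refine Finset.sum_congr rfl fun S _ => ?_
  rw [← Finset.piecewise_compl]
  have h2 : (Sᶜ).piecewise (fun j => (-1 : ℝ) • (Pi.single (a j) 1 : ℝ → ℝ))
      (fun j => Pi.single (b j) 1) =
      (Sᶜ).piecewise (fun j => (-1 : ℝ) • (fun j => Pi.single (if j ∈ S then b j else a j) 1 :
        ι → ℝ → ℝ) j) (fun j => Pi.single (if j ∈ S then b j else a j) 1) := by
    ext j t
    by_cases hj : j ∈ S <;> simp [hj, Finset.piecewise]
  rw [h2, MultilinearMap.map_piecewise_smul, gridForm_single]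
  · simp
  · intro j
    split_ifs
    exacts [hb j, ha j]

lemma sum_telescope_above {V : Type*} [AddCommGroup V] (φ : ℝ → V) {m : ℕ} (e : Fin (m + 1) → ℝ)
    (he : Monotone e) (p : ℝ) (hp : p ∈ Set.range e) :
    ∑ k : Fin m, (if p < e k.succ then φ (e k.succ) - φ (e k.castSucc) else 0) =
      φ (e (Fin.last m)) - φ p := by
  have tel : ∀ (ψ : ℝ → V) (m : ℕ) (e : Fin (m + 1) → ℝ),
      ∑ k : Fin m, (ψ (e k.succ) - ψ (e k.castSucc)) = ψ (e (Fin.last m)) - ψ (e 0) := by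
    intro ψ m
    induction m with
    | zero => intro e; simp
    | succ m ih =>
      intro e
      rw [Fin.sum_univ_castSucc]
      have := ih (fun i => e i.castSucc)
      simp only [Fin.succ_castSucc] at this ⊢
      rw [this]
      simp
  obtain ⟨i, rfl⟩ := hp
  -- Truncating the argument below at p kills the increments of the cells not above p, and the
  -- others stay unchanged because p is a grid point.
  have h := tel (fun t => φ (max t (e i))) m e
  simp only [max_eq_left (he (Fin.le_last i)), max_eq_right (he (Fin.zero_le i))] at h
  rw [← h]
  refine Finset.sum_congr rfl fun k _ => ?_
  split_ifs with hk
  · have hik : i < k.succ := he.reflect_lt hk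
    rw [max_eq_left hk.le, max_eq_left (he (Fin.le_castSucc_iff.2 hik))]
  · push Not at hk
    rw [max_eq_right hk, max_eq_right ((he (Fin.castSucc_lt_succ).le).trans hk), sub_self]

/-- The mixed difference of `g` over the cell `k` of the grid `e × … × e`. -/
def cellDifference (g : (ι → ℝ) → ℝ) {m : ℕ} (e : Fin (m + 1) → ℝ) (k : ι → Fin m) : ℝ :=
  mixedDifference g (fun j => e (k j).castSucc) (fun j => e (k j).succ)

/-- In each coordinate δ_1 − δ_p telescopes over the grid steps above p (with 1 standing for the
last grid point). Multilinearity multiplies these expansions, and the product of the one-dimensional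
conditions is `below`. -/
lemma mixedDifference_last_eq_sum (g : (ι → ℝ) → ℝ) {m : ℕ} (e : Fin (m + 1) → ℝ)
    (he : Monotone e) (p : ι → ℝ) (hp : ∀ j, p j ∈ Set.range e) :
    mixedDifference g p (fun _ => e (Fin.last m)) =
      ∑ k : ι → Fin m, cellDifference g e k * below p (fun j => e (k j).succ) := by
  have hm : ∀ i, e i ∈ Finset.univ.image e := fun i => Finset.mem_image_of_mem _ (Finset.mem_univ i)
  rw [mixedDifference_eq_gridForm g (Finset.univ.image e)]
  rotate_left
  · intro j
    obtain ⟨i, hi⟩ := hp j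
    rw [← hi]
    exact hm i
  · exact fun j => hm _
  have h : (fun j => Pi.single (e (Fin.last m)) 1 - Pi.single (p j) 1 : ι → ℝ → ℝ) =
      fun j => ∑ k : Fin m, (if p j < e k.succ then (1 : ℝ) else 0) •
        (Pi.single (e k.succ) 1 - Pi.single (e k.castSucc) 1 : ℝ → ℝ) := by
    funext j
    rw [← sum_telescope_above (fun t => (Pi.single t 1 : ℝ → ℝ)) e he (p j) (hp j)]
    refine Finset.sum_congr rfl fun k _ => ?_
    split_ifs <;> simp
  rw [h, MultilinearMap.map_sum]
  refine Finset.sum_congr rfl fun k _ => ?_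
  rw [MultilinearMap.map_smul_univ, cellDifference,
    mixedDifference_eq_gridForm g (Finset.univ.image e) _ _ (fun j => hm _) (fun j => hm _),
    smul_eq_mul, mul_comm, below]

lemma sum_abs_cellDifference_le (g : (ι → ℝ) → ℝ) (hg : vitaliVariation g < ∞) {m : ℕ}
    (e : Fin (m + 1) → ℝ) (he : Monotone e) (h0 : e 0 = 0) (h1 : e (Fin.last m) = 1) :
    ∑ k : ι → Fin m, |cellDifference g e k| ≤ (vitaliVariation g).toReal := by
  rw [← ENNReal.ofReal_le_iff_le_toReal hg.ne,
    ENNReal.ofReal_sum_of_nonneg fun _ _ => abs_nonneg _]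
  exact le_iSup (fun P : CubePartition ι => ∑ k : (∀ j, Fin (P.size j)),
    ENNReal.ofReal |mixedDifference g
      (fun j => P.pt j (k j).castSucc) (fun j => P.pt j (k j).succ)|)
    ⟨fun _ => m, fun _ => e, fun _ => he, fun _ => h0, fun _ => h1⟩

lemma exists_grid (A : Finset ℝ) (hA : ∀ a ∈ A, 0 ≤ a ∧ a ≤ 1) :
    ∃ (m : ℕ) (e : Fin (m + 1) → ℝ), Monotone e ∧ e 0 = 0 ∧ e (Fin.last m) = 1 ∧
      ∀ a ∈ A, a ∈ Set.range e := by
  set B : Finset ℝ := insert 0 (insert 1 A) with hB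
  have hBI : ∀ b ∈ B, 0 ≤ b ∧ b ≤ 1 := by
    intro b hb
    simp only [hB, Finset.mem_insert] at hb
    rcases hb with rfl | rfl | hb
    · norm_num
    · norm_num
    · exact hA b hb
  have hcard : B.card = (B.card - 1) + 1 :=
    (Nat.succ_pred_eq_of_pos (Finset.card_pos.2 ⟨0, by simp [hB]⟩)).symm
  have hr : Set.range (B.orderEmbOfFin hcard) = B := Finset.range_orderEmbOfFin B hcard
  have hmono : Monotone (B.orderEmbOfFin hcard) := (B.orderEmbOfFin hcard).monotone
  refine ⟨B.card - 1, B.orderEmbOfFin hcard, hmono, ?_, ?_, ?_⟩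
  · refine le_antisymm ?_ (hBI _ (Finset.orderEmbOfFin_mem B hcard _)).1
    have h0 : (0 : ℝ) ∈ Set.range (B.orderEmbOfFin hcard) := by rw [hr]; simp [hB]
    obtain ⟨i, hi⟩ := h0
    rw [← hi]
    exact hmono (Fin.zero_le i)
  · refine le_antisymm (hBI _ (Finset.orderEmbOfFin_mem B hcard _)).2 ?_
    have h0 : (1 : ℝ) ∈ Set.range (B.orderEmbOfFin hcard) := by rw [hr]; simp [hB]
    obtain ⟨i, hi⟩ := h0
    rw [← hi]
    exact hmono (Fin.le_last i)
  · intro a ha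
    rw [hr]
    simp [hB, ha]

/-- Expand every mixed difference over one grid through all the points and exchange sums: each cell
difference is then multiplied by a weighted count of points below a corner, which is at most `D`. -/
lemma abs_sum_mixedDifference_le (g : (ι → ℝ) → ℝ) (hg : vitaliVariation g < ∞) {κ : Type*}
    (s : Finset κ) (w : κ → ℝ) (p : κ → ι → ℝ) (hp : ∀ i ∈ s, ∀ j, 0 ≤ p i j ∧ p i j ≤ 1) (D : ℝ)
    (hD : ∀ t : ι → ℝ, (∀ j, 0 ≤ t j ∧ t j ≤ 1) → |∑ i ∈ s, w i * below (p i) t| ≤ D) :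
    |∑ i ∈ s, w i * mixedDifference g (p i) (fun _ => 1)| ≤ (vitaliVariation g).toReal * D := by
  classical
  obtain ⟨m, e, he, h0, h1, hA⟩ := exists_grid (s.biUnion fun i => Finset.univ.image (p i)) (by
    intro a ha
    simp only [Finset.mem_biUnion, Finset.mem_image, Finset.mem_univ, true_and] at ha
    obtain ⟨i, hi, j, rfl⟩ := ha
    exact hp i hi j)
  have hpe : ∀ i ∈ s, ∀ j, p i j ∈ Set.range e := fun i hi j => hA _ (by
    simp only [Finset.mem_biUnion, Finset.mem_image, Finset.mem_univ, true_and]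
    exact ⟨i, hi, j, rfl⟩)
  have hD0 : 0 ≤ D := (abs_nonneg _).trans (hD (fun _ => 0) fun _ => by norm_num)
  have key : ∑ i ∈ s, w i * mixedDifference g (p i) (fun _ => 1) =
      ∑ k : ι → Fin m, cellDifference g e k * ∑ i ∈ s, w i * below (p i) fun j => e (k j).succ := by
    simp_rw [Finset.mul_sum]
    rw [Finset.sum_comm]
    refine Finset.sum_congr rfl fun i hi => ?_
    rw [← h1, mixedDifference_last_eq_sum g e he (p i) (hpe i hi), Finset.mul_sum]
    exact Finset.sum_congr rfl fun k _ => by ring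
  rw [key]
  calc |∑ k : ι → Fin m, cellDifference g e k * ∑ i ∈ s, w i * below (p i) fun j => e (k j).succ|
      ≤ ∑ k : ι → Fin m, |cellDifference g e k| * D := by
        refine (Finset.abs_sum_le_sum_abs _ _).trans (Finset.sum_le_sum fun k _ => ?_)
        rw [abs_mul]
        refine mul_le_mul_of_nonneg_left (hD _ fun j => ?_) (abs_nonneg _)
        exact ⟨h0 ▸ he (Fin.zero_le _), h1 ▸ he (Fin.le_last _)⟩
    _ ≤ (vitaliVariation g).toReal * D := by
        rw [← Finset.sum_mul]
        exact mul_le_mul_of_nonneg_right (sum_abs_cellDifference_le g hg e he h0 h1) hD0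

end MixedDifference

/-! ### Decomposition over faces and the Koksma–Hlawka inequality -/

section HardyKrause

variable {r : ℕ}

lemma mixedDifference_faceRestriction (f : (Fin r → ℝ) → ℝ) (u : Finset (Fin r)) (p : Fin r → ℝ) :
    mixedDifference (faceRestriction f u) (fun j => p j) (fun _ => 1) =
      ∑ W ∈ u.powerset, (-1 : ℝ) ^ W.card * f (fun i => if i ∈ W then p i else 1) := by
  rw [mixedDifference]
  -- `W` collects the coordinates taken from p, hence the complement of the set of upper
  -- coordinates.
  refine Finset.sum_nbij' (fun S => (Sᶜ).map (Function.Embedding.subtype _))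
    (fun W => (W.subtype (· ∈ u))ᶜ) ?_ ?_ ?_ ?_ ?_
  · intro S _
    rw [Finset.mem_powerset]
    intro i hi
    simp only [Finset.mem_map, Function.Embedding.subtype_apply] at hi
    obtain ⟨a, -, rfl⟩ := hi
    exact a.2
  · simp
  · intro S _
    ext i
    simp
  · intro W hW
    rw [Finset.mem_powerset] at hW
    ext i
    simp only [compl_compl, Finset.mem_map, Finset.mem_subtype, Function.Embedding.subtype_apply]
    constructor
    · rintro ⟨a, ha, rfl⟩
      exact ha
    · intro hi
      exact ⟨⟨i, hW hi⟩, hi, rfl⟩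
  · intro S _
    rw [Finset.card_map, faceRestriction]
    congr 2
    funext i
    by_cases hi : i ∈ u
    · by_cases hS : (⟨i, hi⟩ : u) ∈ S <;> simp [hi, hS]
    · simp [hi]

/-- Expand ∏ (−1 + [j ∉ W]): a factor vanishes as soon as some j lies outside W. -/
lemma sum_neg_one_pow_card_superset {α : Type*} [Fintype α] [DecidableEq α] (W : Finset α) :
    ∑ u : Finset α, (if W ⊆ u then (-1 : ℝ) ^ u.card else 0) =
      if W = Finset.univ then (-1 : ℝ) ^ (Fintype.card α) else 0 := by
  have h := Finset.prod_add (fun _ : α => (-1 : ℝ)) (fun j => if j ∈ W then 0 else 1) Finset.univ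
  rw [Finset.powerset_univ] at h
  have h1 : ∀ u : Finset α, (∏ i ∈ u, (-1 : ℝ)) * ∏ i ∈ Finset.univ \ u,
      (if i ∈ W then (0 : ℝ) else 1) = if W ⊆ u then (-1 : ℝ) ^ u.card else 0 := by
    intro u
    split_ifs with hW
    · rw [Finset.prod_const, Finset.prod_eq_one, mul_one]
      intro i hi
      rw [if_neg]
      intro hiW
      exact (Finset.mem_sdiff.1 hi).2 (hW hiW)
    · obtain ⟨i, hiW, hiu⟩ := Finset.not_subset.1 hW
      have h0 : ∏ i ∈ Finset.univ \ u, (if i ∈ W then (0 : ℝ) else 1) = 0 :=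
        Finset.prod_eq_zero (i := i) (by simp [hiu]) (by simp [hiW])
      rw [h0, mul_zero]
  rw [Finset.sum_congr rfl fun u _ => h1 u] at h
  rw [← h]
  split_ifs with hW
  · subst hW
    simp [Finset.card_univ]
  · obtain ⟨i, hi⟩ : ∃ i, i ∉ W := by
      by_contra! hc
      exact hW (Finset.eq_univ_iff_forall.2 hc)
    exact Finset.prod_eq_zero (Finset.mem_univ i) (by simp [hi])

/-- Möbius inversion on the lattice of subsets: after exchanging sums only the vertex with all
coordinates taken from p survives. -/
lemma eq_sum_mixedDifference_faceRestriction (f : (Fin r → ℝ) → ℝ) (p : Fin r → ℝ) :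
    f p = ∑ u : Finset (Fin r), (-1 : ℝ) ^ u.card *
      mixedDifference (faceRestriction f u) (fun j => p j) (fun _ => 1) := by
  have h1 : ∀ u : Finset (Fin r), (-1 : ℝ) ^ u.card *
      mixedDifference (faceRestriction f u) (fun j => p j) (fun _ => 1) =
      ∑ W : Finset (Fin r), ((-1 : ℝ) ^ W.card * f (fun i => if i ∈ W then p i else 1)) *
        (if W ⊆ u then (-1 : ℝ) ^ u.card else 0) := by
    intro u
    rw [mixedDifference_faceRestriction, Finset.mul_sum]
    simp_rw [mul_ite, mul_zero]
    rw [← Finset.sum_filter]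
    refine Finset.sum_congr ?_ fun W _ => by ring
    ext W
    simp
  simp_rw [h1]
  rw [Finset.sum_comm]
  simp_rw [← Finset.mul_sum, sum_neg_one_pow_card_superset]
  rw [Finset.sum_eq_single Finset.univ]
  · simp only [Finset.mem_univ, if_true, Finset.card_univ, Fintype.card_fin]
    rw [mul_right_comm, ← pow_add, Even.neg_one_pow ⟨r, rfl⟩, one_mul]
  · intro W _ hW
    rw [if_neg hW, mul_zero]
  · simp

/-- The variation in the sense of Hardy and Krause. -/
def hardyKrauseVariation (f : (Fin r → ℝ) → ℝ) : ℝ :=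
  ∑ u ∈ Finset.univ.filter (fun u : Finset (Fin r) => u.Nonempty),
    (vitaliVariation (faceRestriction f u)).toReal

lemma hardyKrauseVariation_nonneg (f : (Fin r → ℝ) → ℝ) : 0 ≤ hardyKrauseVariation f :=
  Finset.sum_nonneg fun _ _ => ENNReal.toReal_nonneg

/-- A discrete form of the Koksma–Hlawka inequality. -/
theorem abs_sum_mul_le_hardyKrauseVariation (f : (Fin r → ℝ) → ℝ) (hf : IsBVHardyKrause f)
    {κ : Type*} (s : Finset κ) (w : κ → ℝ) (hw : ∑ i ∈ s, w i = 0) (p : κ → Fin r → ℝ)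
    (hp : ∀ i ∈ s, ∀ j, 0 ≤ p i j ∧ p i j < 1) (D : ℝ)
    (hD : ∀ t : Fin r → ℝ, (∀ j, 0 ≤ t j ∧ t j ≤ 1) → |∑ i ∈ s, w i * below (p i) t| ≤ D) :
    |∑ i ∈ s, w i * f (p i)| ≤ hardyKrauseVariation f * D := by
  have h1 : ∑ i ∈ s, w i * f (p i) = ∑ u : Finset (Fin r), (-1 : ℝ) ^ u.card *
      ∑ i ∈ s, w i * mixedDifference (faceRestriction f u) (fun j => p i j) (fun _ => 1) := by
    simp_rw [Finset.mul_sum]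
    rw [Finset.sum_comm]
    refine Finset.sum_congr rfl fun i _ => ?_
    rw [eq_sum_mixedDifference_faceRestriction f (p i), Finset.mul_sum]
    exact Finset.sum_congr rfl fun u _ => by ring
  rw [h1, hardyKrauseVariation, Finset.sum_mul, Finset.sum_filter]
  refine (Finset.abs_sum_le_sum_abs _ _).trans (Finset.sum_le_sum fun u _ => ?_)
  rw [abs_mul, abs_pow, abs_neg, abs_one, one_pow, one_mul]
  split_ifs with hu
  · refine abs_sum_mixedDifference_le _ (hf u hu) s w (fun i j => p i j)
      (fun i hi j => ⟨(hp i hi j).1, (hp i hi j).2.le⟩) D fun t ht => ?_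
    -- A box on a face becomes a full box with sides 1 outside `u`; since the points have
    -- coordinates strictly below 1, the extra factors equal 1.
    convert hD (fun j => if h : j ∈ u then t ⟨j, h⟩ else 1) ?_ using 2
    · refine Finset.sum_congr rfl fun i hi => ?_
      congr 1
      rw [below, below, ← Finset.prod_subset (s₁ := u) (Finset.subset_univ u) fun j _ hj => by
        simp [hj, (hp i hi j).2]]
      refine Eq.trans ?_ (Finset.prod_coe_sort u _)
      exact Finset.prod_congr rfl fun j _ => by simp
    · intro j
      split_ifs with h
      · exact ht _
      · norm_num
  -- The empty face contributes the constant f(1,…,1), which the zero total weight cancels.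
  · rw [Finset.not_nonempty_iff_eq_empty] at hu
    subst hu
    have : ∀ i, mixedDifference (faceRestriction f ∅) (fun j => p i j) (fun _ => 1) =
        f (fun _ => 1) := by
      intro i
      rw [mixedDifference_faceRestriction]
      simp
    simp_rw [this, ← Finset.sum_mul, hw]
    simp

lemma abs_sub_le_hardyKrauseVariation (f : (Fin r → ℝ) → ℝ) (hf : IsBVHardyKrause f)
    (p q : Fin r → ℝ) (hp : ∀ j, 0 ≤ p j ∧ p j < 1) (hq : ∀ j, 0 ≤ q j ∧ q j < 1) :
    |f p - f q| ≤ hardyKrauseVariation f := by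
  have h := abs_sum_mul_le_hardyKrauseVariation f hf (Finset.univ : Finset Bool)
    (fun b => if b then 1 else -1) (by simp) (fun b => if b then p else q)
    (by intro b _; cases b <;> simpa) 1 (by
      intro t _
      have h1 := below_nonneg p t
      have h2 := below_le_one p t
      have h3 := below_nonneg q t
      have h4 := below_le_one q t
      simp only [Fintype.sum_bool, if_true, Bool.false_eq_true, if_false, abs_le]
      constructor <;> linarith)
  simpa [sub_eq_add_neg] using h

end HardyKrause

/-! ### Measurability and integrability of functions of bounded variation -/

section Measurability

variable {ι : Type*}

/-- The nearest point of the unit cube. -/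
def clampCube (x : ι → ℝ) : ι → ℝ := fun j => max 0 (min 1 (x j))

lemma clampCube_mono : Monotone (clampCube (ι := ι)) := fun _ _ h j =>
  max_le_max le_rfl (min_le_min le_rfl (h j))

lemma clampCube_mem (x : ι → ℝ) (j : ι) : 0 ≤ clampCube x j ∧ clampCube x j ≤ 1 :=
  ⟨le_max_left _ _, max_le zero_le_one (min_le_left _ _)⟩

lemma clampCube_eq_self (x : ι → ℝ) (hx : ∀ j, 0 ≤ x j ∧ x j ≤ 1) : clampCube x = x := by
  funext j
  rw [clampCube, min_eq_right (hx j).2, max_eq_right (hx j).1]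

variable [Fintype ι]

/-- Superlevel sets are lower sets, hence order-connected, hence null measurable; they need not be
Borel. -/
lemma _root_.Antitone.aemeasurable_pi {h : (ι → ℝ) → ℝ} (hh : Antitone h) :
    AEMeasurable h (volume : Measure (ι → ℝ)) := by
  have : NullMeasurable h (volume : Measure (ι → ℝ)) := by
    refine measurable_of_Ioi (α := ℝ) (δ := NullMeasurableSpace (ι → ℝ) volume) fun c => ?_
    refine Set.OrdConnected.nullMeasurableSet (IsLowerSet.ordConnected ?_)
    intro x y hyx hx
    exact lt_of_lt_of_le hx (hh hyx)
  exact this.aemeasurable_of_aerange (t := Set.univ) (by simp)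

/-- Every mixed difference with upper corner `1` is dominated, increment by increment, by a
function that decreases in each coordinate. -/
lemma exists_antitone_dominating [DecidableEq ι] (g : (ι → ℝ) → ℝ) (hg : vitaliVariation g < ∞) :
    ∃ W : (ι → ℝ) → ℝ, ∀ x y : ι → ℝ, x ≤ y → (∀ j, 0 ≤ x j ∧ x j ≤ 1) →
      (∀ j, 0 ≤ y j ∧ y j ≤ 1) →
      |mixedDifference g x (fun _ => 1) - mixedDifference g y (fun _ => 1)| ≤ W x - W y := by
  classical
  have hgrid : ∀ A : Finset ℝ, ∃ (m : ℕ) (e : Fin (m + 1) → ℝ), Monotone e ∧ e 0 = 0 ∧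
      e (Fin.last m) = 1 ∧ ∀ a ∈ A, (0 ≤ a ∧ a ≤ 1) → a ∈ Set.range e := by
    intro A
    obtain ⟨m, e, h⟩ := exists_grid (A.filter fun a => 0 ≤ a ∧ a ≤ 1) (by simp)
    exact ⟨m, e, h.1, h.2.1, h.2.2.1, fun a ha ha' => h.2.2.2 a (by simp [ha, ha'])⟩
  choose m e he h0 h1 hA using hgrid
  set V : Finset ℝ → (ι → ℝ) → ℝ := fun A x =>
    ∑ k : ι → Fin (m A), |cellDifference g (e A) k| * below x (fun j => e A (k j).succ) with hV
  have hV0 : ∀ A x, 0 ≤ V A x := fun A x =>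
    Finset.sum_nonneg fun k _ => mul_nonneg (abs_nonneg _) (below_nonneg _ _)
  have hV1 : ∀ A x, V A x ≤ (vitaliVariation g).toReal := fun A x =>
    (Finset.sum_le_sum fun k _ => mul_le_of_le_one_right (abs_nonneg _) (below_le_one _ _)).trans
      (sum_abs_cellDifference_le g hg (e A) (he A) (h0 A) (h1 A))
  have hVb : ∀ x, IsBoundedUnder (· ≤ ·) atTop (fun A => V A x) := fun x =>
    isBoundedUnder_of ⟨_, fun A => hV1 A x⟩
  have hVc : ∀ x, IsCoboundedUnder (· ≤ ·) atTop (fun A => V A x) := fun x =>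
    (isBoundedUnder_of ⟨0, fun A => hV0 A x⟩ :
      IsBoundedUnder (· ≥ ·) atTop (fun A => V A x)).isCoboundedUnder_le
  -- The domination holds on every grid whose index set `A` contains the coordinates of x and y,
  -- hence eventually. The limsup over finite sets removes the dependence on the grid without
  -- requiring `V` to be monotone in `A`.
  refine ⟨fun x => limsup (fun A => V A x) atTop, fun x y hxy hx hy => ?_⟩
  rw [le_sub_iff_add_le, ← limsup_const_add atTop _ _ (hVb y) (hVc y)]
  refine limsup_le_limsup ?_ ?_ (hVb x)
  · filter_upwards [eventually_ge_atTop (Finset.univ.image x ∪ Finset.univ.image y)] with A hAxy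
    have hxA : ∀ j, x j ∈ Set.range (e A) := fun j => hA A _ (hAxy (by simp)) (hx j)
    have hyA : ∀ j, y j ∈ Set.range (e A) := fun j => hA A _ (hAxy (by simp)) (hy j)
    rw [← le_sub_iff_add_le, ← h1 A, mixedDifference_last_eq_sum g (e A) (he A) x hxA,
      mixedDifference_last_eq_sum g (e A) (he A) y hyA, ← Finset.sum_sub_distrib,
      ← Finset.sum_sub_distrib]
    refine (Finset.abs_sum_le_sum_abs _ _).trans (Finset.sum_le_sum fun k _ => ?_)
    rw [← mul_sub, ← mul_sub, abs_mul, abs_of_nonneg (sub_nonneg.2 (below_anti _ hxy))]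
  · refine (isBoundedUnder_of ⟨0, fun A => ?_⟩ :
      IsBoundedUnder (· ≥ ·) atTop _).isCoboundedUnder_le
    exact add_nonneg (abs_nonneg _) (hV0 A y)

variable {r : ℕ}

/-- A Jordan decomposition: if W dominates the increments of a mixed difference M, then W + M and W
are antitone, and M is their difference. Clamping extends this monotonicity to the whole space. -/
lemma aemeasurable_comp_clampCube (f : (Fin r → ℝ) → ℝ) (hf : IsBVHardyKrause f) :
    AEMeasurable (fun x => f (clampCube x)) (volume : Measure (Fin r → ℝ)) := by
  have h : (fun x => f (clampCube x)) = fun x => ∑ u : Finset (Fin r), (-1 : ℝ) ^ u.card *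
      mixedDifference (faceRestriction f u) (fun j => clampCube x j) (fun _ => 1) := by
    funext x
    exact eq_sum_mixedDifference_faceRestriction f _
  rw [h]
  refine Finset.aemeasurable_fun_sum _ fun u _ => AEMeasurable.const_mul ?_ _
  by_cases hu : u.Nonempty
  · obtain ⟨W, hW⟩ := exists_antitone_dominating _ (hf u hu)
    have key : ∀ x y : Fin r → ℝ, x ≤ y →
        |mixedDifference (faceRestriction f u) (fun j => clampCube x j) (fun _ => 1) -
          mixedDifference (faceRestriction f u) (fun j => clampCube y j) (fun _ => 1)| ≤
        W (fun j => clampCube x j) - W (fun j => clampCube y j) := fun x y hxy =>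
      hW _ _ (fun j => clampCube_mono hxy j) (fun j => clampCube_mem x j)
        (fun j => clampCube_mem y j)
    have h1 : Antitone fun x : Fin r → ℝ => W (fun j : u => clampCube x j) := fun x y hxy =>
      sub_nonneg.1 ((abs_nonneg _).trans (key x y hxy))
    have h2 : Antitone fun x : Fin r → ℝ => W (fun j : u => clampCube x j) +
        mixedDifference (faceRestriction f u) (fun j => clampCube x j) (fun _ => 1) := by
      intro x y hxy
      have := (abs_le.1 (key x y hxy)).1
      dsimp only
      linarith
    convert h2.aemeasurable_pi.sub h1.aemeasurable_pi using 1
    funext x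
    simp
  · rw [Finset.not_nonempty_iff_eq_empty] at hu
    subst hu
    simp_rw [mixedDifference_faceRestriction]
    simp

/-- On (0,1] the representative in [0,1) of the class of a point is the point itself except at the
null point 1. -/
lemma measurePreserving_equivIco : MeasurePreserving
    (fun x : UnitAddCircle => ((AddCircle.equivIco (1 : ℝ) 0 x : Set.Ico (0 : ℝ) (0 + 1)) : ℝ))
    volume (volume.restrict (Set.Ioc (0 : ℝ) 1)) := by
  have hmeas : Measurable (fun x : UnitAddCircle =>
      ((AddCircle.equivIco (1 : ℝ) 0 x : Set.Ico (0 : ℝ) (0 + 1)) : ℝ)) :=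
    measurable_subtype_coe.comp (AddCircle.measurableEquivIco (1 : ℝ) 0).measurable
  refine ⟨hmeas, ?_⟩
  have hmk := AddCircle.measurePreserving_mk 1 0
  rw [zero_add] at hmk
  rw [← hmk.map_eq, Measure.map_map hmeas hmk.measurable]
  conv_rhs => rw [← Measure.map_id (μ := volume.restrict (Set.Ioc (0 : ℝ) 1))]
  refine Measure.map_congr ?_
  rw [EventuallyEq, ae_restrict_iff' measurableSet_Ioc]
  have h1 : ∀ᵐ x : ℝ, x ≠ 1 := by simp [ae_iff]
  filter_upwards [h1] with x hx hx'
  simp only [Function.comp_apply, id]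
  rw [AddCircle.coe_equivIco_mk_apply]
  simp only [div_one, mul_one]
  exact Int.fract_eq_self.2 ⟨hx'.1.le, lt_of_le_of_ne hx'.2 hx⟩

lemma equivIco_mem (x : UnitAddCircle) : 0 ≤ (AddCircle.equivIco (1 : ℝ) 0 x : ℝ) ∧
    (AddCircle.equivIco (1 : ℝ) 0 x : ℝ) < 1 := by
  have := (AddCircle.equivIco (1 : ℝ) 0 x).2
  simpa using this

lemma integrable_onTorus (f : (Fin r → ℝ) → ℝ) (hf : IsBVHardyKrause f) :
    Integrable (onTorus f) (volume : Measure (UnitAddTorus (Fin r))) := by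
  have hρ := measurePreserving_pi (fun _ : Fin r => (volume : Measure UnitAddCircle))
    (fun _ => volume.restrict (Set.Ioc (0 : ℝ) 1)) (fun _ => measurePreserving_equivIco)
  -- Almost everywhere measurability pulls back only along maps under which preimages of null sets
  -- are null.
  have hq : Measure.QuasiMeasurePreserving (fun (x : Fin r → UnitAddCircle) i =>
      ((AddCircle.equivIco (1 : ℝ) 0 (x i) : Set.Ico (0 : ℝ) (0 + 1)) : ℝ))
      volume volume := by
    refine ⟨hρ.measurable, ?_⟩
    rw [volume_pi, hρ.map_eq, ← Measure.restrict_pi_pi]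
    exact Measure.absolutelyContinuous_of_le Measure.restrict_le_self
  have hm : AEStronglyMeasurable (onTorus f) (volume : Measure (UnitAddTorus (Fin r))) := by
    have h := (aemeasurable_comp_clampCube f hf).comp_quasiMeasurePreserving hq
    refine h.aestronglyMeasurable.congr (Eventually.of_forall fun x => ?_)
    simp only [Function.comp_apply, onTorus]
    rw [clampCube_eq_self]
    exact fun j => ⟨(equivIco_mem _).1, (equivIco_mem _).2.le⟩
  refine Integrable.of_bound hm (|f 0| + hardyKrauseVariation f)
    (Eventually.of_forall fun x => ?_)
  rw [Real.norm_eq_abs]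
  have := abs_sub_le_hardyKrauseVariation f hf _ 0 (fun j => equivIco_mem (x j)) (by simp)
  have h2 := abs_sub_abs_le_abs_sub (onTorus f x) (f 0)
  rw [onTorus] at h2 ⊢
  linarith

end Measurability

/-! ### The Fejér kernel and smoothed indicators of arcs -/

section Fejer

/-- The character `t ↦ exp (2πit)` of the real line. -/
def unitExp (t : ℝ) : ℂ := Complex.exp ((2 * Real.pi * t : ℝ) * Complex.I)

lemma unitExp_add (s t : ℝ) : unitExp (s + t) = unitExp s * unitExp t := by
  rw [unitExp, unitExp, unitExp, ← Complex.exp_add]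
  push_cast
  ring_nf

@[simp] lemma unitExp_zero : unitExp 0 = 1 := by simp [unitExp]

lemma norm_unitExp (t : ℝ) : ‖unitExp t‖ = 1 := Complex.norm_exp_ofReal_mul_I _

lemma unitExp_sum {κ : Type*} (s : Finset κ) (t : κ → ℝ) :
    unitExp (∑ i ∈ s, t i) = ∏ i ∈ s, unitExp (t i) := by
  classical
  induction s using Finset.induction_on with
  | empty => simp
  | insert a s ha ih => rw [Finset.sum_insert ha, Finset.prod_insert ha, unitExp_add, ih]

lemma unitExp_nat_mul (k : ℕ) (t : ℝ) : unitExp (k * t) = unitExp t ^ k := by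
  rw [unitExp, unitExp, ← Complex.exp_nat_mul]
  push_cast
  ring_nf

lemma unitExp_int (k : ℤ) : unitExp k = 1 := by
  rw [unitExp]
  convert Complex.exp_int_mul_two_pi_mul_I k using 2
  push_cast
  ring

lemma conj_unitExp (t : ℝ) : (starRingEnd ℂ) (unitExp t) = unitExp (-t) := by
  rw [unitExp, unitExp, ← Complex.exp_conj, map_mul, Complex.conj_ofReal, Complex.conj_I]
  push_cast
  ring_nf

lemma continuous_unitExp : Continuous unitExp := by
  unfold unitExp
  fun_prop

lemma norm_unitExp_sub_one (t : ℝ) : ‖unitExp t - 1‖ = 2 * |Real.sin (Real.pi * t)| := by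
  rw [unitExp, mul_comm, Complex.norm_exp_I_mul_ofReal_sub_one, Real.norm_eq_abs, abs_mul]
  rw [abs_two, show 2 * Real.pi * t / 2 = Real.pi * t by ring]

lemma two_mul_abs_le_abs_sin {t : ℝ} (ht : |t| ≤ 1 / 2) : 2 * |t| ≤ |Real.sin (Real.pi * t)| := by
  have h := Real.mul_abs_le_abs_sin (x := Real.pi * t) (by
    rw [abs_mul, abs_of_pos Real.pi_pos]
    nlinarith [Real.pi_pos])
  rw [abs_mul, abs_of_pos Real.pi_pos, ← mul_assoc, div_mul_cancel₀ _ Real.pi_ne_zero] at h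
  exact h

lemma two_mul_distInt_le_abs_sin (t : ℝ) : 2 * distInt t ≤ |Real.sin (Real.pi * t)| := by
  have h := two_mul_abs_le_abs_sin (abs_sub_round t)
  rw [mul_sub, mul_comm Real.pi (round t : ℝ), Real.sin_sub_int_mul_pi, abs_mul,
    abs_zpow, abs_neg, abs_one, one_zpow, one_mul] at h
  exact h

lemma norm_sum_unitExp_mul_abs_sin_le (n : ℕ) (t : ℝ) :
    ‖∑ k ∈ Finset.range n, unitExp (k * t)‖ * |Real.sin (Real.pi * t)| ≤ 1 := by
  have h : (∑ k ∈ Finset.range n, unitExp (k * t)) * (unitExp t - 1) = unitExp t ^ n - 1 := by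
    simp_rw [unitExp_nat_mul]
    exact geom_sum_mul _ _
  have h2 : ‖∑ k ∈ Finset.range n, unitExp (k * t)‖ * ‖unitExp t - 1‖ ≤ 2 := by
    rw [← norm_mul, h]
    refine (norm_sub_le _ _).trans ?_
    rw [norm_pow, norm_unitExp, one_pow, norm_one]
    norm_num
  rw [norm_unitExp_sub_one] at h2
  linarith

/-- The Fejér kernel, normalised to have integral `1` over a period. -/
def fejer (H : ℕ) (y : ℝ) : ℝ := ‖∑ k ∈ Finset.range H, unitExp (k * y)‖ ^ 2 / H

lemma fejer_nonneg (H : ℕ) (y : ℝ) : 0 ≤ fejer H y := by unfold fejer; positivity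

lemma continuous_fejer (H : ℕ) : Continuous (fejer H) := by
  unfold fejer
  have := continuous_unitExp
  fun_prop

lemma fejer_periodic (H : ℕ) : Function.Periodic (fejer H) 1 := by
  intro y
  have : ∀ k : ℕ, unitExp (k * (y + 1)) = unitExp (k * y) := by
    intro k
    rw [mul_add, unitExp_add, mul_one]
    have := unitExp_int k
    rw [Int.cast_natCast] at this
    rw [this, mul_one]
  simp_rw [fejer, this]

lemma fejer_neg (H : ℕ) (y : ℝ) : fejer H (-y) = fejer H y := by
  have : ∑ k ∈ Finset.range H, unitExp (k * -y) =
      (starRingEnd ℂ) (∑ k ∈ Finset.range H, unitExp (k * y)) := by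
    rw [map_sum]
    refine Finset.sum_congr rfl fun k _ => ?_
    rw [conj_unitExp, mul_neg]
  rw [fejer, fejer, this, RCLike.norm_conj]

lemma fejer_le (H : ℕ) {y : ℝ} (hy : 0 < y) (hy2 : y ≤ 1 / 2) :
    fejer H y ≤ 1 / (4 * H) * y ^ (-2 : ℝ) := by
  have h1 := norm_sum_unitExp_mul_abs_sin_le H y
  have h2 := two_mul_abs_le_abs_sin (t := y) (by rwa [abs_of_pos hy])
  rw [abs_of_pos hy] at h2
  set N := ‖∑ k ∈ Finset.range H, unitExp (k * y)‖ with hN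
  have hN0 : 0 ≤ N := norm_nonneg _
  have h3 : N * (2 * y) ≤ 1 := (mul_le_mul_of_nonneg_left h2 hN0).trans h1
  have h4 : N ^ 2 ≤ 1 / 4 * y ^ (-2 : ℝ) := by
    rw [Real.rpow_neg hy.le, ← div_eq_mul_inv, le_div_iff₀ (by positivity)]
    norm_num
    nlinarith [mul_nonneg hN0 hy.le]
  rw [fejer, ← hN]
  calc N ^ 2 / H ≤ (1 / 4 * y ^ (-2 : ℝ)) / H := by gcongr
    _ = _ := by rw [div_eq_mul_inv, one_div, one_div, mul_inv]; ring

/-- The Fourier coefficients of the Fejér kernel. -/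
def fejerCoeff (H : ℕ) (h : ℤ) : ℝ :=
  (((Finset.range H ×ˢ Finset.range H).filter
    fun q : ℕ × ℕ => (q.1 : ℤ) - q.2 = h).card : ℝ) / H

lemma fejerCoeff_nonneg (H : ℕ) (h : ℤ) : 0 ≤ fejerCoeff H h := by unfold fejerCoeff; positivity

lemma fejerCoeff_le_one (H : ℕ) (h : ℤ) : fejerCoeff H h ≤ 1 := by
  refine div_le_one_of_le₀ ?_ (Nat.cast_nonneg _)
  rw [Nat.cast_le]
  refine (Finset.card_le_card_of_injOn Prod.fst (t := Finset.range H) ?_ ?_).trans_eq (by simp)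
  · intro q hq
    simp only [Finset.coe_filter, Finset.mem_product, Set.mem_ofPred_eq] at hq
    exact hq.1.1
  · intro q hq q' hq' he
    simp only [Finset.coe_filter, Finset.mem_product, Set.mem_ofPred_eq] at hq hq'
    ext
    · exact he
    · have := hq.2
      have := hq'.2
      omega

lemma fejerCoeff_zero {H : ℕ} (hH : 0 < H) : fejerCoeff H 0 = 1 := by
  have : (Finset.range H ×ˢ Finset.range H).filter (fun q : ℕ × ℕ => (q.1 : ℤ) - q.2 = 0) =
      (Finset.range H).image fun k => (k, k) := by
    ext ⟨a, b⟩
    simp only [Finset.mem_filter, Finset.mem_product, Finset.mem_range, Finset.mem_image,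
      Prod.mk.injEq]
    constructor
    · rintro ⟨⟨h1, h2⟩, h3⟩
      exact ⟨a, h1, rfl, by omega⟩
    · rintro ⟨k, hk, rfl, rfl⟩
      simp [hk]
  rw [fejerCoeff, this, Finset.card_image_of_injective _ (fun a b h => (Prod.mk.inj h).1),
    Finset.card_range, div_self]
  exact_mod_cast hH.ne'

lemma fejer_eq_sum (H : ℕ) (y : ℝ) : (fejer H y : ℂ) =
    ∑ h ∈ Finset.Ioo (-(H : ℤ)) H, (fejerCoeff H h : ℂ) * unitExp (h * y) := by
  have h1 : ((‖∑ k ∈ Finset.range H, unitExp (k * y)‖ ^ 2 : ℝ) : ℂ) =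
      ∑ q ∈ Finset.range H ×ˢ Finset.range H, unitExp (((q.1 : ℤ) - q.2 : ℤ) * y) := by
    rw [Complex.ofReal_pow, ← Complex.mul_conj', map_sum, Finset.sum_mul_sum, Finset.sum_product]
    refine Finset.sum_congr rfl fun k _ => Finset.sum_congr rfl fun l _ => ?_
    rw [conj_unitExp, ← unitExp_add]
    congr 1
    push_cast
    ring
  rw [fejer, Complex.ofReal_div, h1, Finset.sum_div,
    ← Finset.sum_fiberwise_of_maps_to (s := Finset.range H ×ˢ Finset.range H)
      (t := Finset.Ioo (-(H : ℤ)) H) (g := fun q : ℕ × ℕ => (q.1 : ℤ) - q.2)]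
  · refine Finset.sum_congr rfl fun h _ => ?_
    rw [Finset.sum_congr rfl (g := fun _ => unitExp (h * y) / (H : ℂ))]
    · rw [Finset.sum_const, nsmul_eq_mul, fejerCoeff]
      push_cast
      ring
    · intro q hq
      rw [(Finset.mem_filter.1 hq).2]
      simp
  · intro q hq
    simp only [Finset.mem_product, Finset.mem_range] at hq
    simp only [Finset.mem_Ioo]
    omega

/-- The Fourier coefficients of the indicator of an initial segment `[0, l)` of the circle. -/
def segmentCoeff (l : ℝ) (h : ℤ) : ℂ := ∫ w in (0 : ℝ)..l, unitExp (-(h * w))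

lemma segmentCoeff_zero (l : ℝ) : segmentCoeff l 0 = l := by
  simp [segmentCoeff]

lemma norm_segmentCoeff_le {l : ℝ} (hl : 0 ≤ l ∧ l ≤ 1) (h : ℤ) :
    ‖segmentCoeff l h‖ ≤ 1 / max 1 |(h : ℝ)| := by
  by_cases hh : h = 0
  · subst hh
    rw [segmentCoeff_zero, Complex.norm_real, Real.norm_eq_abs, abs_of_nonneg hl.1]
    simpa using hl.2
  · have h1 : (1 : ℝ) ≤ |(h : ℝ)| := by exact_mod_cast Int.one_le_abs hh
    have hc : (-(2 * Real.pi * h : ℝ) * Complex.I : ℂ) ≠ 0 := by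
      simp [Real.pi_ne_zero, hh]
    have h2 : segmentCoeff l h = (unitExp (-(h * l)) - 1) / (-(2 * Real.pi * h : ℝ) * Complex.I) := by
      have := integral_exp_mul_complex (a := 0) (b := l) hc
      rw [segmentCoeff]
      rw [Complex.ofReal_zero, mul_zero, Complex.exp_zero] at this
      convert this using 4
      · rw [unitExp]
        congr 1
        push_cast
        ring
      · rw [unitExp]
        congr 1
        push_cast
        ring
    rw [h2, norm_div, max_eq_right h1]
    have h3 : ‖(-(2 * Real.pi * h : ℝ) * Complex.I : ℂ)‖ = 2 * Real.pi * |(h : ℝ)| := by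
      rw [norm_mul, Complex.norm_I, mul_one, norm_neg, Complex.norm_real, Real.norm_eq_abs, abs_mul,
        abs_of_pos (by positivity : (0 : ℝ) < 2 * Real.pi)]
    rw [h3]
    have h4 : ‖unitExp (-(h * l)) - 1‖ ≤ 2 := by
      refine (norm_sub_le _ _).trans ?_
      rw [norm_unitExp, norm_one]
      norm_num
    calc ‖unitExp (-(h * l)) - 1‖ / (2 * Real.pi * |(h : ℝ)|)
        ≤ 2 / (2 * Real.pi * |(h : ℝ)|) := by gcongr
      _ ≤ 2 / (2 * |(h : ℝ)|) := by
          gcongr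
          nlinarith [Real.pi_gt_three]
      _ = 1 / |(h : ℝ)| := by
          field_simp

/-- The probability measure on the line whose density is the Fejér kernel on one period. -/
def fejerMeasure (H : ℕ) : Measure ℝ :=
  (volume.restrict (Set.Ioc (-(1 / 2) : ℝ) (1 / 2))).withDensity
    fun y => ENNReal.ofReal (fejer H y)

lemma integral_fejerMeasure (H : ℕ) (g : ℝ → ℂ) : ∫ y, g y ∂(fejerMeasure H) =
    ∫ y in (-(1 / 2) : ℝ)..(1 / 2), (fejer H y : ℂ) * g y := by
  rw [fejerMeasure, integral_withDensity_eq_integral_toReal_smul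
      (continuous_fejer H).measurable.ennreal_ofReal (Eventually.of_forall fun _ => by simp),
    intervalIntegral.integral_of_le (by norm_num)]
  refine integral_congr_ae (Eventually.of_forall fun y => ?_)
  simp [ENNReal.toReal_ofReal (fejer_nonneg H y)]

/-- Convolution with a trigonometric polynomial: periodicity and w = v − y move the indicator onto
[0, l), where the kernel is integrated term by term. -/
lemma integral_indicator_fejerMeasure (H : ℕ) {l : ℝ} (hl : 0 ≤ l ∧ l ≤ 1) (v : ℝ) :
    ∫ y, (if Int.fract (v - y) < l then (1 : ℂ) else 0) ∂(fejerMeasure H) =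
      ∑ h ∈ Finset.Ioo (-(H : ℤ)) H, (fejerCoeff H h * segmentCoeff l h) * unitExp (h * v) := by
  rw [integral_fejerMeasure]
  set G : ℝ → ℂ := fun y => (fejer H y : ℂ) * (if Int.fract (v - y) < l then (1 : ℂ) else 0)
    with hG
  have hper : Function.Periodic G 1 := by
    intro y
    simp only [hG]
    rw [fejer_periodic H y, ← sub_sub, Int.fract_sub_one]
  have h1 : ∫ y in (-(1 / 2) : ℝ)..(1 / 2), G y = ∫ y in (v - 1)..v, G y := by
    have := hper.intervalIntegral_add_eq (-(1 / 2)) (v - 1)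
    norm_num at this
    exact this
  have h2 : ∫ w in (0 : ℝ)..1, G (v - w) = ∫ y in (v - 1)..v, G y := by
    rw [intervalIntegral.integral_comp_sub_left, sub_zero]
  have h3 : ∫ w in (0 : ℝ)..1, G (v - w) = ∫ w in (0 : ℝ)..l, (fejer H (v - w) : ℂ) := by
    rw [intervalIntegral.integral_of_le zero_le_one, intervalIntegral.integral_of_le hl.1,
      integral_Ioc_eq_integral_Ioo, integral_Ioc_eq_integral_Ioo,
      ← integral_indicator measurableSet_Ioo, ← integral_indicator measurableSet_Ioo]
    refine integral_congr_ae (Eventually.of_forall fun w => ?_)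
    simp only [Set.indicator_apply, Set.mem_Ioo, hG, sub_sub_cancel]
    by_cases hw : 0 < w ∧ w < 1
    · rw [if_pos hw, Int.fract_eq_self.2 ⟨hw.1.le, hw.2⟩]
      by_cases hwl : w < l
      · simp [hwl, hw.1]
      · simp [hwl]
    · rw [if_neg hw, if_neg]
      exact fun h => hw ⟨h.1, h.2.trans_le hl.2⟩
  rw [h1, ← h2, h3]
  simp_rw [fejer_eq_sum]
  rw [intervalIntegral.integral_finsetSum]
  · refine Finset.sum_congr rfl fun h _ => ?_
    rw [segmentCoeff, mul_assoc, ← intervalIntegral.integral_mul_const,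
      ← intervalIntegral.integral_const_mul]
    refine intervalIntegral.integral_congr fun w _ => ?_
    rw [← unitExp_add]
    congr 2
    ring
  · intro h _
    refine Continuous.intervalIntegrable ?_ _ _
    have := continuous_unitExp
    fun_prop

/-- Take the full circle l = 1 in the smoothed indicator formula; only the frequency 0 survives,
with coefficient 1. -/
lemma isProbabilityMeasure_fejerMeasure {H : ℕ} (hH : 0 < H) :
    IsProbabilityMeasure (fejerMeasure H) := by
  have h := integral_indicator_fejerMeasure H (l := 1) ⟨zero_le_one, le_rfl⟩ 0
  have h0 : ∀ h ∈ Finset.Ioo (-(H : ℤ)) H, h ≠ 0 →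
      (fejerCoeff H h * segmentCoeff 1 h) * unitExp (h * 0) = 0 := by
    intro h _ hh
    have hc : (-(2 * Real.pi * h : ℝ) * Complex.I : ℂ) ≠ 0 := by
      simp [Real.pi_ne_zero, hh]
    have : segmentCoeff 1 h = 0 := by
      have h1 := integral_exp_mul_complex (a := 0) (b := 1) hc
      have h2 : Complex.exp (-(2 * Real.pi * h : ℝ) * Complex.I * (1 : ℝ)) = 1 := by
        have := unitExp_int (-h)
        rw [unitExp] at this
        rw [← this]
        congr 1
        push_cast
        ring
      rw [h2] at h1
      simp only [Complex.ofReal_zero, mul_zero, Complex.exp_zero, sub_self, zero_div] at h1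
      rw [segmentCoeff, ← h1]
      refine intervalIntegral.integral_congr fun w _ => ?_
      simp only [unitExp]
      congr 1
      push_cast
      ring
    rw [this]
    simp
  rw [Finset.sum_eq_single 0 h0 (fun h => absurd (Finset.mem_Ioo.2 (by omega)) h),
    fejerCoeff_zero hH, segmentCoeff_zero] at h
  simp only [zero_sub, Int.fract_lt_one, if_true, integral_const] at h
  simp only [Int.cast_zero, mul_zero, unitExp_zero, Complex.ofReal_one, mul_one,
    Complex.real_smul] at h
  have h1 : (fejerMeasure H).real Set.univ = 1 := by exact_mod_cast h
  refine ⟨?_⟩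
  rw [Measure.real, ENNReal.toReal_eq_one_iff] at h1
  exact h1

/-- The pointwise bound 1/(4Hy²) is integrated from δ to infinity. -/
lemma fejerMeasure_Ioi_le (H : ℕ) {δ : ℝ} (hδ : 0 < δ) :
    fejerMeasure H (Set.Ioi δ) ≤ ENNReal.ofReal (1 / (4 * H * δ)) := by
  rw [fejerMeasure, withDensity_apply _ measurableSet_Ioi, Measure.restrict_restrict
    measurableSet_Ioi]
  have hint : IntegrableOn (fun y : ℝ => 1 / (4 * H) * y ^ (-2 : ℝ)) (Set.Ioi δ) :=
    (integrableOn_Ioi_rpow_of_lt (by norm_num) hδ).const_mul _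
  calc ∫⁻ y in Set.Ioi δ ∩ Set.Ioc (-(1 / 2)) (1 / 2), ENNReal.ofReal (fejer H y)
      ≤ ∫⁻ y in Set.Ioi δ ∩ Set.Ioc (-(1 / 2)) (1 / 2),
          ENNReal.ofReal (1 / (4 * H) * y ^ (-2 : ℝ)) := by
        refine setLIntegral_mono' (measurableSet_Ioi.inter measurableSet_Ioc) fun y hy => ?_
        exact ENNReal.ofReal_le_ofReal (fejer_le H (hδ.trans hy.1) hy.2.2)
    _ ≤ ∫⁻ y in Set.Ioi δ, ENNReal.ofReal (1 / (4 * H) * y ^ (-2 : ℝ)) :=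
        lintegral_mono_set Set.inter_subset_left
    _ = ENNReal.ofReal (∫ y in Set.Ioi δ, 1 / (4 * H) * y ^ (-2 : ℝ)) := by
        rw [ofReal_integral_eq_lintegral_ofReal hint]
        filter_upwards [ae_restrict_mem measurableSet_Ioi] with y hy
        have : (0 : ℝ) < y := hδ.trans hy
        positivity
    _ ≤ ENNReal.ofReal (1 / (4 * H * δ)) := by
        refine ENNReal.ofReal_le_ofReal (le_of_eq ?_)
        rw [integral_const_mul, integral_Ioi_rpow_of_lt (by norm_num) hδ]
        norm_num
        rw [Real.rpow_neg_one]
        ring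

lemma fejerMeasure_Iio_le (H : ℕ) {δ : ℝ} (hδ : 0 < δ) :
    fejerMeasure H (Set.Iio (-δ)) ≤ ENNReal.ofReal (1 / (4 * H * δ)) := by
  refine le_trans ?_ (fejerMeasure_Ioi_le H hδ)
  rw [fejerMeasure, withDensity_apply _ measurableSet_Iio, withDensity_apply _ measurableSet_Ioi,
    Measure.restrict_restrict measurableSet_Iio, Measure.restrict_restrict measurableSet_Ioi]
  have h1 : Set.Iio (-δ) ∩ Set.Ioc (-(1 / 2) : ℝ) (1 / 2) ⊆
      Neg.neg ⁻¹' (Set.Ioi δ ∩ Set.Icc (-(1 / 2) : ℝ) (1 / 2)) := by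
    intro y hy
    simp only [Set.mem_inter_iff, Set.mem_Iio, Set.mem_Ioc, Set.mem_preimage, Set.mem_Ioi,
      Set.mem_Icc] at hy ⊢
    refine ⟨by linarith, by linarith, by linarith⟩
  refine (lintegral_mono_set h1).trans ?_
  have h2 := (Measure.measurePreserving_neg (volume : Measure ℝ)).setLIntegral_comp_preimage
    (measurableSet_Ioi.inter measurableSet_Icc : MeasurableSet
      (Set.Ioi δ ∩ Set.Icc (-(1 / 2) : ℝ) (1 / 2)))
    (f := fun y => ENNReal.ofReal (fejer H y)) (continuous_fejer H).measurable.ennreal_ofReal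
  simp_rw [fejer_neg] at h2
  rw [h2]
  refine lintegral_mono_set fun y hy => ?_
  exact ⟨hy.1, by have := hy.1; simp only [Set.mem_Ioi] at this; linarith, hy.2.2⟩

lemma fejerMeasure_abs_gt_le (H : ℕ) {δ : ℝ} (hδ : 0 < δ) :
    fejerMeasure H {y | δ < |y|} ≤ ENNReal.ofReal (1 / (2 * H * δ)) := by
  have h : {y : ℝ | δ < |y|} ⊆ Set.Ioi δ ∪ Set.Iio (-δ) := by
    intro y hy
    rcases lt_abs.1 (show δ < |y| from hy) with h | h
    · exact Or.inl h
    · exact Or.inr (by simp only [Set.mem_Iio]; linarith)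
  refine (measure_mono h).trans ((measure_union_le _ _).trans
    ((add_le_add (fejerMeasure_Ioi_le H hδ) (fejerMeasure_Iio_le H hδ)).trans ?_))
  rw [← ENNReal.ofReal_add (by positivity) (by positivity)]
  refine ENNReal.ofReal_le_ofReal (le_of_eq ?_)
  rw [show (4 : ℝ) * H * δ = 2 * (2 * H * δ) by ring, one_div, one_div, mul_inv]
  ring

end Fejer

/-! ### Discrepancy of orbits and the Erdős–Turán–Koksma inequality -/

section Discrepancy

lemma abs_prod_sub_prod_le {κ : Type*} (s : Finset κ) (a b : κ → ℝ)
    (ha : ∀ i, 0 ≤ a i ∧ a i ≤ 1) (hb : ∀ i, 0 ≤ b i ∧ b i ≤ 1) :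
    |∏ i ∈ s, a i - ∏ i ∈ s, b i| ≤ ∑ i ∈ s, |a i - b i| := by
  classical
  induction s using Finset.induction_on with
  | empty => simp
  | insert i s hi ih =>
    rw [Finset.prod_insert hi, Finset.prod_insert hi, Finset.sum_insert hi]
    have h1 : a i * ∏ i ∈ s, a i - b i * ∏ i ∈ s, b i =
        (a i - b i) * ∏ i ∈ s, a i + b i * (∏ i ∈ s, a i - ∏ i ∈ s, b i) := by ring
    rw [h1]
    refine (abs_add_le _ _).trans (add_le_add ?_ ?_)
    · rw [abs_mul]
      refine mul_le_of_le_one_right (abs_nonneg _) ?_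
      rw [abs_of_nonneg (Finset.prod_nonneg fun j _ => (ha j).1)]
      exact Finset.prod_le_one (fun j _ => (ha j).1) fun j _ => (ha j).2
    · rw [abs_mul, abs_of_nonneg (hb i).1]
      exact (mul_le_of_le_one_left (abs_nonneg _) (hb i).2).trans ih

variable {r : ℕ}

/-- The number of `k` with `1 ≤ k ≤ n` for which `kα` lies in the box of the torus with lower
corner `a` and side lengths `l`. -/
def boxCount (α : Fin r → ℝ) (n : ℕ) (a l : Fin r → ℝ) : ℝ :=
  ∑ k ∈ Finset.Icc 1 n, ∏ j, if Int.fract (k * α j - a j) < l j then 1 else 0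

/-- The deviation of `boxCount` from its expected value. -/
def boxDeviation (α : Fin r → ℝ) (n : ℕ) (a l : Fin r → ℝ) : ℝ :=
  boxCount α n a l - n * ∏ j, l j

lemma boxCount_nonneg (α : Fin r → ℝ) (n : ℕ) (a l : Fin r → ℝ) : 0 ≤ boxCount α n a l :=
  Finset.sum_nonneg fun _ _ => Finset.prod_nonneg fun j _ => by split_ifs <;> norm_num

lemma boxCount_le (α : Fin r → ℝ) (n : ℕ) (a l : Fin r → ℝ) : boxCount α n a l ≤ n := by
  have : ∀ k ∈ Finset.Icc 1 n,
      (∏ j, if Int.fract (k * α j - a j) < l j then (1 : ℝ) else 0) ≤ 1 := fun k _ =>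
    Finset.prod_le_one (fun j _ => by split_ifs <;> norm_num) fun j _ => by
      split_ifs <;> norm_num
  exact (Finset.sum_le_sum this).trans (by simp)

lemma boxCount_mono (α : Fin r → ℝ) (n : ℕ) (a l a' l' : Fin r → ℝ)
    (h : ∀ j (v : ℝ), Int.fract (v - a j) < l j → Int.fract (v - a' j) < l' j) :
    boxCount α n a l ≤ boxCount α n a' l' := by
  refine Finset.sum_le_sum fun k _ => Finset.prod_le_prod
    (fun j _ => by split_ifs <;> norm_num) fun j _ => ?_
  by_cases hj : Int.fract (k * α j - a j) < l j
  · rw [if_pos hj, if_pos (h j _ hj)]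
  · rw [if_neg hj]
    split_ifs <;> norm_num

lemma abs_boxDeviation_le (α : Fin r → ℝ) (n : ℕ) (a l : Fin r → ℝ)
    (hl : ∀ j, 0 ≤ l j ∧ l j ≤ 1) : |boxDeviation α n a l| ≤ n := by
  have h1 := boxCount_nonneg α n a l
  have h2 := boxCount_le α n a l
  have h3 : 0 ≤ ∏ j, l j := Finset.prod_nonneg fun j _ => (hl j).1
  have h4 : ∏ j, l j ≤ 1 := Finset.prod_le_one (fun j _ => (hl j).1) fun j _ => (hl j).2
  have h5 : (0 : ℝ) ≤ n := Nat.cast_nonneg n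
  rw [boxDeviation, abs_le]
  constructor <;> nlinarith

/-- Inclusion of an arc translated by s in a longer arc; l' = 1 is the whole circle, where wrapping
around is harmless. -/
lemma fract_add_lt {x l s l' : ℝ} (hx : Int.fract x < l) (hs : 0 ≤ s) (hl' : l' = 1 ∨ l + s ≤ l')
    (h1 : l' ≤ 1) : Int.fract (x + s) < l' := by
  rcases hl' with rfl | hl'
  · exact Int.fract_lt_one _
  · have h0 := Int.fract_nonneg x
    have : Int.fract (x + s) = Int.fract x + s := by
      have h2 : x + s = (Int.fract x + s) + (⌊x⌋ : ℤ) := by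
        have := Int.fract_add_floor x
        linarith
      rw [h2, Int.fract_add_intCast, Int.fract_eq_self.2 ⟨by linarith, by linarith⟩]
    rw [this]
    linarith

/-- The nonzero integer vectors all of whose coordinates are less than `H` in absolute value. -/
def frequencies (r H : ℕ) : Finset (Fin r → ℤ) :=
  (Fintype.piFinset fun _ : Fin r => Finset.Ioo (-(H : ℤ)) H).erase 0

/-- The weighted sum of the exponential sums along the orbit. -/
def expSumBound (α : Fin r → ℝ) (n H : ℕ) : ℝ :=
  ∑ h ∈ frequencies r H,
    (weight h)⁻¹ * ‖∑ k ∈ Finset.Icc 1 n, unitExp (k * ∑ j, h j * α j)‖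

lemma measurable_box (v l : Fin r → ℝ) : Measurable fun y : Fin r → ℝ =>
    ∏ j, if Int.fract (v j - y j) < l j then (1 : ℝ) else 0 := by
  refine Finset.measurable_fun_prod _ fun j _ => Measurable.ite ?_ measurable_const measurable_const
  exact measurableSet_lt (measurable_fract.comp (by fun_prop)) measurable_const

lemma measurable_boxDeviation (α : Fin r → ℝ) (n : ℕ) (b l : Fin r → ℝ) :
    Measurable fun y : Fin r → ℝ => boxDeviation α n (b + y) l := by
  unfold boxDeviation boxCount
  refine Measurable.sub_const (Finset.measurable_fun_sum _ fun k _ => ?_) _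
  simp only [Pi.add_apply, ← sub_sub]
  exact measurable_box (fun j => k * α j - b j) l

lemma integrable_boxDeviation (μ : Measure (Fin r → ℝ)) [IsFiniteMeasure μ] (α : Fin r → ℝ)
    (n : ℕ) (b l : Fin r → ℝ) (hl : ∀ j, 0 ≤ l j ∧ l j ≤ 1) :
    Integrable (fun y : Fin r → ℝ => boxDeviation α n (b + y) l) μ :=
  Integrable.of_bound (measurable_boxDeviation α n b l).aestronglyMeasurable n
    (Eventually.of_forall fun y => abs_boxDeviation_le α n (b + y) l hl)

lemma integral_box_fejerMeasure (H : ℕ) (v l : Fin r → ℝ) (hl : ∀ j, 0 ≤ l j ∧ l j ≤ 1)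
    [SigmaFinite (fejerMeasure H)] :
    ∫ y : Fin r → ℝ, ∏ j, (if Int.fract (v j - y j) < l j then (1 : ℂ) else 0)
        ∂(Measure.pi fun _ => fejerMeasure H) =
      ∑ h ∈ Fintype.piFinset fun _ : Fin r => Finset.Ioo (-(H : ℤ)) H,
        (∏ j, (fejerCoeff H (h j) * segmentCoeff (l j) (h j))) * unitExp (∑ j, h j * v j) := by
  rw [integral_fintype_prod_eq_prod (𝕜 := ℂ)
    (f := fun j y => if Int.fract (v j - y) < l j then (1 : ℂ) else 0)]
  simp_rw [fun j => integral_indicator_fejerMeasure H (hl j) (v j)]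
  rw [Finset.prod_univ_sum]
  refine Finset.sum_congr rfl fun h _ => ?_
  rw [Finset.prod_mul_distrib, unitExp_sum]

/-- After averaging, the zero frequency is exactly the expected count. The remaining coefficients
are at most 1/r(h) in norm, because Fejér coefficients lie in [0,1] and those of an arc decay like
1/|h|. -/
lemma abs_integral_boxDeviation_le {H : ℕ} (hH : 0 < H) (α : Fin r → ℝ) (n : ℕ) (b l : Fin r → ℝ)
    (hl : ∀ j, 0 ≤ l j ∧ l j ≤ 1) :
    |∫ y, boxDeviation α n (b + y) l ∂(Measure.pi fun _ => fejerMeasure H)| ≤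
      expSumBound α n H := by
  have := isProbabilityMeasure_fejerMeasure hH
  set μ : Measure (Fin r → ℝ) := Measure.pi fun _ => fejerMeasure H with hμ
  set c : (Fin r → ℤ) → ℂ := fun h => ∏ j, (fejerCoeff H (h j) * segmentCoeff (l j) (h j)) with hc
  have hint : ∀ k : ℕ, Integrable (fun y : Fin r → ℝ =>
      ∏ j, if Int.fract (k * α j - b j - y j) < l j then (1 : ℂ) else 0) μ := by
    intro k
    have h1 := (measurable_box (fun j => k * α j - b j) l).complex_ofReal
    have h2 : (fun y : Fin r → ℝ => (∏ j, if Int.fract (k * α j - b j - y j) < l j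
        then (1 : ℂ) else 0)) = fun y => ((∏ j, if Int.fract (k * α j - b j - y j) < l j
        then (1 : ℝ) else 0 : ℝ) : ℂ) := by
      funext y
      push_cast [apply_ite Complex.ofReal]
      rfl
    rw [h2]
    refine Integrable.of_bound h1.aestronglyMeasurable 1 (Eventually.of_forall fun y => ?_)
    rw [Complex.norm_real, Real.norm_eq_abs, abs_of_nonneg
      (Finset.prod_nonneg fun j _ => by split_ifs <;> norm_num)]
    exact Finset.prod_le_one (fun j _ => by split_ifs <;> norm_num) fun j _ => by
      split_ifs <;> norm_num
  have key : ((∫ y, boxDeviation α n (b + y) l ∂μ : ℝ) : ℂ) = ∑ h ∈ frequencies r H,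
      c h * unitExp (-∑ j, h j * b j) *
        ∑ k ∈ Finset.Icc 1 n, unitExp (k * ∑ j, h j * α j) := by
    have e1 : ((∫ y, boxDeviation α n (b + y) l ∂μ : ℝ) : ℂ) =
        (∑ k ∈ Finset.Icc 1 n, ∫ y : Fin r → ℝ,
          (∏ j, if Int.fract (k * α j - b j - y j) < l j then (1 : ℂ) else 0) ∂μ) -
        n * ∏ j, (l j : ℂ) := by
      rw [← integral_finsetSum _ fun k _ => hint k, ← integral_complex_ofReal]
      have : (n * ∏ j, (l j : ℂ)) = ∫ _, (n * ∏ j, (l j : ℂ)) ∂μ := by simp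
      rw [this, ← integral_sub (integrable_finsetSum _ fun k _ => hint k) (integrable_const _)]
      refine integral_congr_ae (Eventually.of_forall fun y => ?_)
      simp only [boxDeviation, boxCount, Pi.add_apply, ← sub_sub]
      push_cast [apply_ite Complex.ofReal]
      rfl
    have e2 : ∀ k : ℕ, ∫ y : Fin r → ℝ,
        (∏ j, if Int.fract (k * α j - b j - y j) < l j then (1 : ℂ) else 0) ∂μ =
        (∏ j, (l j : ℂ)) + ∑ h ∈ frequencies r H,
          c h * unitExp (-∑ j, h j * b j) * unitExp (k * ∑ j, h j * α j) := by
      intro k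
      rw [integral_box_fejerMeasure H (fun j => k * α j - b j) l hl, frequencies,
        ← Finset.add_sum_erase _ _ (a := 0)]
      · congr 1
        · simp [fejerCoeff_zero hH, segmentCoeff_zero]
        · refine Finset.sum_congr rfl fun h _ => ?_
          rw [mul_assoc, ← unitExp_add]
          congr 2
          rw [Finset.mul_sum, ← Finset.sum_neg_distrib, ← Finset.sum_add_distrib]
          exact Finset.sum_congr rfl fun j _ => by ring
      · rw [Fintype.mem_piFinset]
        intro j
        simp [hH]
    simp_rw [e1, e2]
    rw [Finset.sum_add_distrib, Finset.sum_const, Finset.sum_comm]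
    simp [Finset.mul_sum]
  rw [← Real.norm_eq_abs, ← Complex.norm_real, key]
  refine (norm_sum_le _ _).trans (Finset.sum_le_sum fun h _ => ?_)
  rw [norm_mul, norm_mul, norm_unitExp, mul_one]
  refine mul_le_mul_of_nonneg_right ?_ (norm_nonneg _)
  rw [hc, weight, norm_prod, ← Finset.prod_inv_distrib]
  refine Finset.prod_le_prod (fun j _ => norm_nonneg _) fun j _ => ?_
  rw [norm_mul, Complex.norm_real, Real.norm_eq_abs, abs_of_nonneg (fejerCoeff_nonneg _ _),
    ← one_div]
  exact (mul_le_of_le_one_left (norm_nonneg _) (fejerCoeff_le_one _ _)).trans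
    (norm_segmentCoeff_le (hl j) _)

lemma pi_fejerMeasure_far_le {H : ℕ} (hH : 0 < H) {δ : ℝ} (hδ : 0 < δ) :
    (Measure.pi fun _ : Fin r => fejerMeasure H).real {y | ∃ j, δ < |y j|} ≤
      r * (1 / (2 * H * δ)) := by
  have := isProbabilityMeasure_fejerMeasure hH
  have h1 : {y : Fin r → ℝ | ∃ j, δ < |y j|} = ⋃ j, Function.eval j ⁻¹' {t : ℝ | δ < |t|} := by
    ext y
    simp
  have hm : MeasurableSet {t : ℝ | δ < |t|} := measurableSet_lt measurable_const measurable_abs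
  rw [h1]
  refine (measureReal_iUnion_fintype_le _).trans ?_
  calc ∑ j, (Measure.pi fun _ : Fin r => fejerMeasure H).real
        (Function.eval j ⁻¹' {t : ℝ | δ < |t|}) ≤ ∑ _j : Fin r, 1 / (2 * H * δ) := by
        refine Finset.sum_le_sum fun j _ => ?_
        rw [measureReal_def, (measurePreserving_eval (fun _ : Fin r => fejerMeasure H)
          j).measure_preimage hm.nullMeasurableSet]
        exact ENNReal.toReal_le_of_le_ofReal (by positivity) (fejerMeasure_abs_gt_le H hδ)
    _ = _ := by simp

/-- A form of the inequality of Erdős–Turán–Koksma for the orbits of a rotation. -/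
theorem abs_boxDeviation_le_expSumBound (hr : 1 ≤ r) {H : ℕ} (hH : 0 < H) (α : Fin r → ℝ) (n : ℕ)
    (a l : Fin r → ℝ) (hl : ∀ j, 0 ≤ l j ∧ l j ≤ 1) :
    |boxDeviation α n a l| ≤ 2 * expSumBound α n H + 8 * r ^ 2 * (n / H) := by
  have := isProbabilityMeasure_fejerMeasure hH
  set μ : Measure (Fin r → ℝ) := Measure.pi fun _ => fejerMeasure H with hμ
  have hH' : (0 : ℝ) < H := by exact_mod_cast hH
  have hr' : (0 : ℝ) < r := by exact_mod_cast hr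
  have hn : (0 : ℝ) ≤ n := Nat.cast_nonneg n
  -- This scale makes the probability of a shift exceeding δ in some coordinate at most 1/4.
  set δ : ℝ := 2 * r / H with hδdef
  have hδ : 0 < δ := by positivity
  set F : Set (Fin r → ℝ) := {y | ∃ j, δ < |y j|} with hF
  have hFm : MeasurableSet F := by
    have : F = ⋃ j, {y | δ < |y j|} := by ext y; simp [hF]
    rw [this]
    exact MeasurableSet.iUnion fun j => measurableSet_lt measurable_const
      (measurable_abs.comp (measurable_pi_apply j))
  have hFμ : μ.real F ≤ 1 / 4 := by
    refine (pi_fejerMeasure_far_le hH hδ).trans (le_of_eq ?_)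
    rw [hδdef]
    field_simp
    norm_num
  set S : Set ℝ := {x | ∃ a l : Fin r → ℝ, (∀ j, 0 ≤ l j ∧ l j ≤ 1) ∧ x = |boxDeviation α n a l|}
    with hS
  have hSb : BddAbove S := by
    refine ⟨n, ?_⟩
    rintro x ⟨a, l, hl, rfl⟩
    exact abs_boxDeviation_le α n a l hl
  set D := sSup S with hD
  have hDle : ∀ a l : Fin r → ℝ, (∀ j, 0 ≤ l j ∧ l j ≤ 1) → |boxDeviation α n a l| ≤ D :=
    fun a l hl => le_csSup hSb ⟨a, l, hl, rfl⟩
  have hD0 : 0 ≤ D := (abs_nonneg _).trans (hDle a l hl)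
  -- On `F` the inequality can fail by at most 2D, which costs 2D · 1/4 = D/2 after averaging. The
  -- sign ε treats upper and lower bounds together.
  have avg : ∀ (b m : Fin r → ℝ) (C ε : ℝ), (∀ j, 0 ≤ m j ∧ m j ≤ 1) → |ε| = 1 →
      (∀ y ∉ F, C ≤ ε * boxDeviation α n (b + y) m) → C ≤ D → C ≤ expSumBound α n H + D / 2 := by
    intro b m C ε hm hε hnear hC
    have hint := integrable_boxDeviation μ α n b m hm
    have hind : Integrable (F.indicator fun _ => 2 * D) μ := (integrable_const _).indicator hFm
    have h1 : ∀ y, C ≤ ε * boxDeviation α n (b + y) m + F.indicator (fun _ => 2 * D) y := by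
      intro y
      by_cases hy : y ∈ F
      · rw [Set.indicator_of_mem hy]
        have h2 : |ε * boxDeviation α n (b + y) m| ≤ D := by
          rw [abs_mul, hε, one_mul]
          exact hDle _ _ hm
        have := (abs_le.1 h2).1
        linarith
      · rw [Set.indicator_of_notMem hy, add_zero]
        exact hnear y hy
    have h2 := integral_mono (integrable_const C) ((hint.const_mul ε).add hind) h1
    rw [integral_add' (hint.const_mul ε) hind, integral_const_mul, integral_indicator_const _ hFm]
      at h2
    simp only [integral_const, probReal_univ, smul_eq_mul] at h2
    have h3 : ε * ∫ y, boxDeviation α n (b + y) m ∂μ ≤ expSumBound α n H := by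
      refine (le_abs_self _).trans ?_
      rw [abs_mul, hε, one_mul]
      exact abs_integral_boxDeviation_le hH α n b m hm
    nlinarith
  have step : ∀ a l : Fin r → ℝ, (∀ j, 0 ≤ l j ∧ l j ≤ 1) →
      |boxDeviation α n a l| ≤ expSumBound α n H + D / 2 + n * (r * (2 * δ)) := by
    intro a l hl
    have hDal := abs_le.1 (hDle a l hl)
    rw [abs_le']
    constructor
    -- The enlarged box with corner a − δ contains the original one after every shift by at most δ.
    · set m : Fin r → ℝ := fun j => min 1 (l j + 2 * δ) with hm
      have hm1 : ∀ j, 0 ≤ m j ∧ m j ≤ 1 := fun j =>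
        ⟨le_min zero_le_one (by linarith [(hl j).1]), min_le_left _ _⟩
      have hlm : ∏ j, l j ≤ ∏ j, m j := Finset.prod_le_prod (fun j _ => (hl j).1) fun j _ =>
        le_min (hl j).2 (by linarith)
      have hvol : ∏ j, m j - ∏ j, l j ≤ r * (2 * δ) := by
        refine (le_abs_self _).trans ((abs_prod_sub_prod_le _ m l hm1 hl).trans ?_)
        calc ∑ j, |m j - l j| ≤ ∑ _j : Fin r, 2 * δ := Finset.sum_le_sum fun j _ => by
              rw [abs_le]
              constructor
              · linarith [le_min (hl j).2 (by linarith : l j ≤ l j + 2 * δ)]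
              · linarith [min_le_right 1 (l j + 2 * δ)]
          _ = _ := by simp
      have := avg (fun j => a j - δ) m (boxCount α n a l - n * ∏ j, m j) 1 hm1 abs_one
        (fun y hy => by
          rw [one_mul, boxDeviation]
          refine sub_le_sub_right (boxCount_mono α n _ _ _ _ fun j v hv => ?_) _
          have hy' : |y j| ≤ δ := by
            by_contra! hc
            exact hy ⟨j, hc⟩
          have hy2 := abs_le.1 hy'
          have := fract_add_lt (s := δ - y j) (l' := m j) hv (by linarith)
            (by
              rcases le_total 1 (l j + 2 * δ) with h | h
              · exact Or.inl (min_eq_left h)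
              · right
                simp only [hm, min_eq_right h]
                linarith) (hm1 j).2
          convert this using 2
          simp only [Pi.add_apply]
          ring)
        (by
          have h5 := hDal.2
          rw [boxDeviation] at h5
          nlinarith)
      rw [boxDeviation]
      nlinarith
    -- Dually, the shrunken box with corner a + δ stays inside the original one.
    · set m : Fin r → ℝ := fun j => max 0 (l j - 2 * δ) with hm
      have hm1 : ∀ j, 0 ≤ m j ∧ m j ≤ 1 := fun j =>
        ⟨le_max_left _ _, max_le zero_le_one (by linarith [(hl j).2])⟩
      have hlm : ∏ j, m j ≤ ∏ j, l j := Finset.prod_le_prod (fun j _ => (hm1 j).1) fun j _ =>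
        max_le (hl j).1 (by linarith)
      have hvol : ∏ j, l j - ∏ j, m j ≤ r * (2 * δ) := by
        refine (le_abs_self _).trans ((abs_prod_sub_prod_le _ l m hl hm1).trans ?_)
        calc ∑ j, |l j - m j| ≤ ∑ _j : Fin r, 2 * δ := Finset.sum_le_sum fun j _ => by
              rw [abs_le]
              constructor
              · linarith [max_le (hl j).1 (by linarith : l j - 2 * δ ≤ l j)]
              · linarith [le_max_right 0 (l j - 2 * δ)]
          _ = _ := by simp
      have := avg (fun j => a j + δ) m (n * ∏ j, m j - boxCount α n a l) (-1) hm1 (by simp)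
        (fun y hy => by
          rw [neg_one_mul, boxDeviation, neg_sub]
          refine sub_le_sub_left (boxCount_mono α n _ _ _ _ fun j v hv => ?_) _
          have hy' : |y j| ≤ δ := by
            by_contra! hc
            exact hy ⟨j, hc⟩
          have hy2 := abs_le.1 hy'
          have := fract_add_lt (s := δ + y j) (l' := l j) hv (by linarith)
            (by
              right
              rcases le_total 0 (l j - 2 * δ) with h | h
              · simp only [hm, max_eq_right h]
                linarith
              · simp only [hm, max_eq_left h] at hv
                exact absurd (Int.fract_nonneg _) (not_le.2 hv)) (hl j).2
          convert this using 2
          simp only [Pi.add_apply]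
          ring)
        (by
          have h5 := hDal.1
          rw [boxDeviation] at h5
          nlinarith)
      rw [boxDeviation]
      nlinarith
  -- Since D is finite, D/2 can be absorbed on the left; this is why D ranges over all boxes of the
  -- torus.
  have hfin : D ≤ expSumBound α n H + D / 2 + n * (r * (2 * δ)) := by
    refine csSup_le ⟨_, a, l, hl, rfl⟩ ?_
    rintro x ⟨a, l, hl, rfl⟩
    exact step a l hl
  have heq : n * (r * (2 * δ)) = 4 * r ^ 2 * (n / H) := by
    rw [hδdef]
    ring
  have := hDle a l hl
  linarith

lemma norm_sum_unitExp_le (n : ℕ) {t : ℝ} (ht : 0 < distInt t) :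
    ‖∑ k ∈ Finset.Icc 1 n, unitExp (k * t)‖ ≤ (distInt t)⁻¹ := by
  have h1 : ∑ k ∈ Finset.Icc 1 n, unitExp (k * t) =
      unitExp t * ∑ k ∈ Finset.range n, unitExp (k * t) := by
    rw [Finset.mul_sum, Finset.range_eq_Ico, Finset.sum_Ico_eq_sum_range,
      ← Finset.Ico_add_one_right_eq_Icc, Finset.sum_Ico_eq_sum_range]
    simp only [add_tsub_cancel_right, tsub_zero, zero_add]
    refine Finset.sum_congr rfl fun k _ => ?_
    rw [← unitExp_add]
    congr 1
    push_cast
    ring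
  rw [h1, norm_mul, norm_unitExp, one_mul]
  have h2 := norm_sum_unitExp_mul_abs_sin_le n t
  have h3 := two_mul_distInt_le_abs_sin t
  rw [← one_div, le_div_iff₀ ht]
  refine le_trans (mul_le_mul_of_nonneg_left ?_ (norm_nonneg _)) h2
  linarith

/-- The sum over small frequencies that controls the discrepancy of the orbits. -/
def smallDivisorSum (α : Fin r → ℝ) (H : ℕ) : ℝ :=
  ∑ h ∈ frequencies r H, (weight h)⁻¹ * (distInt (∑ j, h j * α j))⁻¹

lemma weight_pos (h : Fin r → ℤ) : 0 < weight h :=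
  Finset.prod_pos fun _ _ => lt_max_of_lt_left one_pos

lemma one_le_weight (h : Fin r → ℤ) : 1 ≤ weight h := by
  have := Finset.prod_le_prod (s := Finset.univ) (f := fun _ : Fin r => (1 : ℝ))
    (g := fun i => max 1 |(h i : ℝ)|) (fun _ _ => zero_le_one) fun i _ => le_max_left _ _
  simpa [weight] using this

lemma DiophantineWith.distInt_pos {α : Fin r → ℝ} {σ : ℝ} (hα : DiophantineWith α σ)
    {h : Fin r → ℤ} (hh : h ≠ 0) : 0 < distInt (∑ j, h j * α j) := by
  obtain ⟨c, hc, H⟩ := hα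
  exact pos_of_mul_pos_right (hc.trans_le (H h hh)) (Real.rpow_nonneg (weight_pos h).le _)

theorem abs_boxDeviation_le_smallDivisorSum (hr : 1 ≤ r) {H : ℕ} (hH : 0 < H) {α : Fin r → ℝ}
    {σ : ℝ} (hα : DiophantineWith α σ) (n : ℕ)
    (a l : Fin r → ℝ) (hl : ∀ j, 0 ≤ l j ∧ l j ≤ 1) :
    |boxDeviation α n a l| ≤ 2 * smallDivisorSum α H + 8 * r ^ 2 * (n / H) := by
  refine (abs_boxDeviation_le_expSumBound hr hH α n a l hl).trans ?_
  gcongr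
  refine Finset.sum_le_sum fun h hh => ?_
  exact mul_le_mul_of_nonneg_left
    (norm_sum_unitExp_le n (hα.distInt_pos (Finset.ne_of_mem_erase hh)))
    (inv_nonneg.2 (weight_pos h).le)

end Discrepancy

/-! ### From discrepancy to Birkhoff sums -/

section Orbits

variable {r : ℕ}

lemma iterate_rotation_apply (α : Fin r → ℝ) (k : ℕ) (x : UnitAddTorus (Fin r)) (j : Fin r) :
    (rotation α)^[k] x j =
      (((AddCircle.equivIco (1 : ℝ) 0 (x j) : ℝ) + k * α j : ℝ) : UnitAddCircle) := by
  induction k with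
  | zero => simp [AddCircle.coe_equivIco]
  | succ k ih =>
    rw [Function.iterate_succ_apply', rotation, ih, ← AddCircle.coe_add]
    congr 1
    push_cast
    ring

lemma equivIco_iterate_rotation (α : Fin r → ℝ) (k : ℕ) (x : UnitAddTorus (Fin r)) (j : Fin r) :
    (AddCircle.equivIco (1 : ℝ) 0 ((rotation α)^[k] x j) : ℝ) =
      Int.fract (k * α j - -(AddCircle.equivIco (1 : ℝ) 0 (x j) : ℝ)) := by
  rw [iterate_rotation_apply, AddCircle.coe_equivIco_mk_apply]
  simp only [div_one, mul_one]
  congr 1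
  ring

/-- The starting point is absorbed into the corner of the box, so bounds over all boxes are uniform
in x. -/
lemma sum_below_orbit (α : Fin r → ℝ) (n : ℕ) (x : UnitAddTorus (Fin r)) (t : Fin r → ℝ) :
    ∑ k ∈ Finset.Icc 1 n, below
        (fun j => (AddCircle.equivIco (1 : ℝ) 0 ((rotation α)^[k] x j) : ℝ)) t =
      boxCount α n (fun j => -(AddCircle.equivIco (1 : ℝ) 0 (x j) : ℝ)) t := by
  simp_rw [below, equivIco_iterate_rotation]
  rfl

instance : IsProbabilityMeasure (volume : Measure UnitAddCircle) := ⟨UnitAddCircle.measure_univ⟩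

lemma measurePreserving_iterate_rotation (α : Fin r → ℝ) (k : ℕ) :
    MeasurePreserving ((rotation α)^[k]) (volume : Measure (UnitAddTorus (Fin r))) volume := by
  refine MeasurePreserving.iterate ?_ k
  have h : ∀ i, MeasurePreserving (fun t : UnitAddCircle => t + (α i : UnitAddCircle))
      volume volume := fun i => measurePreserving_add_right _ _
  exact measurePreserving_pi (fun _ : Fin r => (volume : Measure UnitAddCircle))
    (fun _ : Fin r => (volume : Measure UnitAddCircle)) h

/-- Comparison of the orbits of two points. -/
lemma abs_orbit_sum_sub_le (f : (Fin r → ℝ) → ℝ) (hf : IsBVHardyKrause f) (α : Fin r → ℝ)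
    (D : ℕ → ℝ) (hD : ∀ (n : ℕ) (a l : Fin r → ℝ), (∀ j, 0 ≤ l j ∧ l j ≤ 1) →
      |boxDeviation α n a l| ≤ D n) (n : ℕ) {M : ℕ} (hM : 0 < M) (x y : UnitAddTorus (Fin r)) :
    |∑ k ∈ Finset.Icc 1 n, onTorus f ((rotation α)^[k] x) -
        n / M * ∑ k ∈ Finset.Icc 1 M, onTorus f ((rotation α)^[k] y)| ≤
      hardyKrauseVariation f * (D n + n * (D M / M)) := by
  have hM' : (M : ℝ) ≠ 0 := by exact_mod_cast hM.ne'
  have h := abs_sum_mul_le_hardyKrauseVariation f hf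
    ((Finset.Icc 1 n).disjSum (Finset.Icc 1 M)) (Sum.elim (fun _ => 1) fun _ => -(n / M : ℝ))
    (by
      simp [Finset.sum_disjSum]
      field_simp
      ring)
    (Sum.elim (fun k j => (AddCircle.equivIco (1 : ℝ) 0 ((rotation α)^[k] x j) : ℝ))
      fun k j => (AddCircle.equivIco (1 : ℝ) 0 ((rotation α)^[k] y j) : ℝ))
    (by
      rintro (k | k) _ j
      · exact equivIco_mem _
      · exact equivIco_mem _)
    (D n + n * (D M / M)) (by
      intro t ht
      simp only [Finset.sum_disjSum, Sum.elim_inl, Sum.elim_inr, one_mul]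
      rw [← Finset.mul_sum, sum_below_orbit, sum_below_orbit]
      have h1 := hD n (fun j => -(AddCircle.equivIco (1 : ℝ) 0 (x j) : ℝ)) t ht
      have h2 := hD M (fun j => -(AddCircle.equivIco (1 : ℝ) 0 (y j) : ℝ)) t ht
      -- The expected counts of the two orbits cancel because the total weight is zero.
      have h3 : ∀ A B : ℝ, A + -(n / M) * B =
          (A - n * ∏ j, t j) - n / M * (B - M * ∏ j, t j) := by
        intro A B
        field_simp
        ring
      rw [h3, ← boxDeviation, ← boxDeviation]
      refine (abs_sub _ _).trans (add_le_add h1 ?_)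
      rw [abs_mul, abs_of_nonneg (by positivity : (0 : ℝ) ≤ n / M)]
      calc _ ≤ (n / M : ℝ) * D M := by gcongr
        _ = _ := by ring)
  simp only [Finset.sum_disjSum, Sum.elim_inl, Sum.elim_inr, one_mul] at h
  rw [← Finset.mul_sum, neg_mul, ← sub_eq_add_neg] at h
  exact h

/-- By invariance, the average over y of the orbit sum of length M, times n/M, is n∫f. The
comparison of two orbits therefore bounds the deviation, and the error from the second orbit
vanishes as M → ∞. -/
theorem abs_birkhoffDeviation_le (f : (Fin r → ℝ) → ℝ) (hf : IsBVHardyKrause f) (α : Fin r → ℝ)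
    (D : ℕ → ℝ) (hD : ∀ (n : ℕ) (a l : Fin r → ℝ), (∀ j, 0 ≤ l j ∧ l j ≤ 1) →
      |boxDeviation α n a l| ≤ D n) (hlim : Tendsto (fun M : ℕ => D M / M) atTop (nhds 0)) (n : ℕ)
    (x : UnitAddTorus (Fin r)) :
    |birkhoffDeviation f α n x| ≤ hardyKrauseVariation f * D n := by
  have hI := integrable_onTorus f hf
  have hIk : ∀ k, Integrable (fun y => onTorus f ((rotation α)^[k] y))
      (volume : Measure (UnitAddTorus (Fin r))) := fun k =>
    (measurePreserving_iterate_rotation α k).integrable_comp_of_integrable hI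
  have hk : ∀ k, ∫ y : UnitAddTorus (Fin r), onTorus f ((rotation α)^[k] y) =
      ∫ t : UnitAddTorus (Fin r), onTorus f t := by
    intro k
    have hmp := measurePreserving_iterate_rotation α k
    conv_rhs => rw [← hmp.map_eq]
    rw [integral_map hmp.measurable.aemeasurable]
    rw [hmp.map_eq]
    exact hI.aestronglyMeasurable
  have hbound : ∀ M : ℕ, 0 < M → |birkhoffDeviation f α n x| ≤
      hardyKrauseVariation f * (D n + n * (D M / M)) := by
    intro M hM
    have hM' : (M : ℝ) ≠ 0 := by exact_mod_cast hM.ne'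
    have e : birkhoffDeviation f α n x = ∫ y : UnitAddTorus (Fin r),
        (∑ k ∈ Finset.Icc 1 n, onTorus f ((rotation α)^[k] x) -
          n / M * ∑ k ∈ Finset.Icc 1 M, onTorus f ((rotation α)^[k] y)) := by
      rw [integral_sub (integrable_const _)
        ((integrable_finsetSum _ fun k _ => hIk k).const_mul _), integral_const_mul,
        integral_finsetSum _ fun k _ => hIk k]
      simp_rw [hk]
      simp only [birkhoffDeviation, Finset.sum_sub_distrib, integral_const, probReal_univ,
        Finset.sum_const, Nat.card_Icc, add_tsub_cancel_right, nsmul_eq_mul, smul_eq_mul, one_mul]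
      field_simp
    rw [e, ← Real.norm_eq_abs]
    refine (norm_integral_le_of_norm_le_const (Eventually.of_forall fun y =>
      abs_orbit_sum_sub_le f hf α D hD n hM x y)).trans ?_
    simp
  have hl : Tendsto (fun M : ℕ => hardyKrauseVariation f * (D n + n * (D M / M))) atTop
      (nhds (hardyKrauseVariation f * (D n + n * 0))) :=
    ((hlim.const_mul _).const_add _).const_mul _
  rw [mul_zero, add_zero] at hl
  exact ge_of_tendsto hl (eventually_atTop.2 ⟨1, fun M hM => hbound M hM⟩)

end Orbits

/-! ### Sums of small divisors -/

section SmallDivisors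

lemma distInt_le_abs_sub_int (t : ℝ) (k : ℤ) : distInt t ≤ |t - k| := round_le t k

/-- Separation makes the integers ⌊φ/δ⌋ distinct; they lie between 1 and 1/δ, so the sum is at most
a harmonic sum divided by δ. -/
lemma sum_inv_distInt_le_of_nonneg {κ : Type*} (B : Finset κ) (φ : κ → ℝ) {δ : ℝ} (hδ : 0 < δ)
    (hδ1 : δ ≤ 1) (h0 : ∀ h ∈ B, δ ≤ φ h) (h1 : ∀ h ∈ B, φ h ≤ 1)
    (hsep : ∀ h ∈ B, ∀ h' ∈ B, h ≠ h' → δ ≤ |φ h - φ h'|) :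
    ∑ h ∈ B, (φ h)⁻¹ ≤ δ⁻¹ * (1 + Real.log δ⁻¹) := by
  set j : κ → ℕ := fun h => ⌊φ h / δ⌋₊ with hj
  have hj1 : ∀ h ∈ B, 1 ≤ j h := fun h hh => by
    rw [hj, Nat.one_le_floor_iff, one_le_div hδ]
    exact h0 h hh
  have hjle : ∀ h ∈ B, (j h : ℝ) ≤ φ h / δ := fun h hh =>
    Nat.floor_le (div_nonneg (hδ.le.trans (h0 h hh)) hδ.le)
  have hinj : Set.InjOn j B := by
    intro h hh h' hh' he
    by_contra hne
    have hs := hsep h hh h' hh' hne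
    have a1 := hjle h hh
    have a2 := hjle h' hh'
    have b1 := Nat.lt_floor_add_one (φ h / δ)
    have b2 := Nat.lt_floor_add_one (φ h' / δ)
    rw [le_div_iff₀ hδ] at a1 a2
    rw [div_lt_iff₀ hδ] at b1 b2
    have he' : (j h : ℝ) = j h' := by exact_mod_cast he
    simp only [hj] at a1 a2 he'
    rw [← he'] at a2 b2
    have : |φ h - φ h'| < δ := by
      rw [abs_lt]
      constructor <;> nlinarith
    linarith
  have hterm : ∀ h ∈ B, (φ h)⁻¹ ≤ δ⁻¹ * ((j h : ℝ))⁻¹ := fun h hh => by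
    have hp : (0 : ℝ) < j h := by exact_mod_cast hj1 h hh
    rw [← mul_inv]
    refine inv_anti₀ (by positivity) ?_
    have := hjle h hh
    rw [le_div_iff₀ hδ] at this
    linarith
  refine (Finset.sum_le_sum hterm).trans ?_
  rw [← Finset.mul_sum]
  refine mul_le_mul_of_nonneg_left ?_ (inv_nonneg.2 hδ.le)
  rw [← Finset.sum_image (f := fun n : ℕ => ((n : ℝ))⁻¹) hinj]
  have hsub : B.image j ⊆ Finset.Icc 1 ⌊δ⁻¹⌋₊ := by
    intro n hn
    obtain ⟨h, hh, rfl⟩ := Finset.mem_image.1 hn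
    refine Finset.mem_Icc.2 ⟨hj1 h hh, Nat.floor_le_floor ?_⟩
    rw [div_le_iff₀ hδ, inv_mul_cancel₀ hδ.ne']
    exact h1 h hh
  refine (Finset.sum_le_sum_of_subset_of_nonneg hsub fun _ _ _ => by positivity).trans ?_
  have hh := harmonic_floor_le_one_add_log δ⁻¹ ((one_le_inv₀ hδ).2 hδ1)
  rw [harmonic_eq_sum_Icc] at hh
  push_cast at hh
  exact hh

lemma sum_inv_distInt_le {κ : Type*} (B : Finset κ) (θ : κ → ℝ) {δ : ℝ} (hδ : 0 < δ)
    (hδ1 : δ ≤ 1) (h0 : ∀ h ∈ B, δ ≤ distInt (θ h))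
    (hsep : ∀ h ∈ B, ∀ h' ∈ B, h ≠ h' → δ ≤ distInt (θ h - θ h')) :
    ∑ h ∈ B, (distInt (θ h))⁻¹ ≤ 2 * (δ⁻¹ * (1 + Real.log δ⁻¹)) := by
  set φ : κ → ℝ := fun h => θ h - round (θ h) with hφ
  have hφ2 : ∀ h, |φ h| ≤ 1 := fun h => (abs_sub_round (θ h)).trans (by norm_num)
  have hφs : ∀ h ∈ B, ∀ h' ∈ B, h ≠ h' → δ ≤ |φ h - φ h'| := by
    intro h hh h' hh' hne
    refine (hsep h hh h' hh' hne).trans ?_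
    refine (distInt_le_abs_sub_int _ (round (θ h) - round (θ h'))).trans (le_of_eq ?_)
    simp only [hφ]
    push_cast
    congr 1
    ring
  rw [← Finset.sum_filter_add_sum_filter_not B (fun h => 0 ≤ φ h), two_mul]
  refine add_le_add ?_ ?_
  · have e : ∀ h ∈ B.filter (fun h => 0 ≤ φ h), distInt (θ h) = φ h := fun h hh =>
      abs_of_nonneg (Finset.mem_filter.1 hh).2
    rw [Finset.sum_congr rfl fun h hh => by rw [e h hh]]
    refine sum_inv_distInt_le_of_nonneg _ φ hδ hδ1 (fun h hh => ?_)
      (fun h _ => (le_abs_self _).trans (hφ2 h)) (fun h hh h' hh' => ?_)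
    · rw [← e h hh]
      exact h0 h (Finset.mem_filter.1 hh).1
    · exact hφs h (Finset.mem_filter.1 hh).1 h' (Finset.mem_filter.1 hh').1
  · have e : ∀ h ∈ B.filter (fun h => ¬ 0 ≤ φ h), distInt (θ h) = -φ h := fun h hh =>
      abs_of_neg (not_le.1 (Finset.mem_filter.1 hh).2)
    rw [Finset.sum_congr rfl fun h hh => by rw [e h hh]]
    refine sum_inv_distInt_le_of_nonneg _ (fun h => -φ h) hδ hδ1 (fun h hh => ?_)
      (fun h _ => (neg_le_abs _).trans (hφ2 h)) (fun h hh h' hh' hne => ?_)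
    · rw [← e h hh]
      exact h0 h (Finset.mem_filter.1 hh).1
    · have := hφs h (Finset.mem_filter.1 hh).1 h' (Finset.mem_filter.1 hh').1 hne
      rwa [neg_sub_neg, abs_sub_comm]

variable {r : ℕ}

/-- The vector of the binary lengths of the coordinates. -/
def binaryLength (h : Fin r → ℤ) : Fin r → ℕ := fun j => (h j).natAbs.size

lemma abs_lt_two_pow_binaryLength (h : Fin r → ℤ) (j : Fin r) :
    |(h j : ℝ)| < 2 ^ binaryLength h j := by
  have := Nat.lt_size_self (h j).natAbs
  rw [← Int.cast_abs, Int.abs_eq_natAbs]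
  exact_mod_cast this

lemma two_pow_binaryLength_le (h : Fin r → ℤ) (j : Fin r) :
    (2 : ℝ) ^ binaryLength h j ≤ 2 * max 1 |(h j : ℝ)| := by
  by_cases h0 : h j = 0
  · simp [binaryLength, h0]
  · have hs : 0 < binaryLength h j := Nat.size_pos.2 (Int.natAbs_pos.2 h0)
    have h1 : 2 ^ (binaryLength h j - 1) ≤ (h j).natAbs := Nat.lt_size.1 (Nat.sub_lt hs one_pos)
    have h2 : (2 : ℝ) ^ (binaryLength h j - 1) ≤ |(h j : ℝ)| := by
      rw [← Int.cast_abs, Int.abs_eq_natAbs]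
      exact_mod_cast h1
    calc (2 : ℝ) ^ binaryLength h j = 2 * 2 ^ (binaryLength h j - 1) := by
          rw [← pow_succ', Nat.sub_add_cancel hs]
      _ ≤ 2 * max 1 |(h j : ℝ)| := by
          gcongr
          exact h2.trans (le_max_right _ _)

lemma two_pow_sum_binaryLength_le (h : Fin r → ℤ) :
    (2 : ℝ) ^ (∑ j, binaryLength h j) ≤ 2 ^ r * weight h := by
  have := Finset.prod_le_prod (s := Finset.univ) (fun j _ => by positivity)
    fun j (_ : j ∈ Finset.univ) => two_pow_binaryLength_le h j
  rw [Finset.prod_pow_eq_pow_sum, Finset.prod_mul_distrib] at this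
  simpa [weight] using this

lemma weight_le_of_abs_le (g : Fin r → ℤ) (m : Fin r → ℕ)
    (h : ∀ j, |(g j : ℝ)| ≤ 2 ^ (m j + 1)) : weight g ≤ 2 ^ (∑ j, m j + r) := by
  have := Finset.prod_le_prod (s := Finset.univ)
    (f := fun j => max 1 |(g j : ℝ)|) (g := fun j => (2 : ℝ) ^ (m j + 1))
    (fun j _ => by positivity) fun j _ => max_le (one_le_pow₀ one_le_two) (h j)
  rw [Finset.prod_pow_eq_pow_sum, Finset.sum_add_distrib] at this
  simpa [weight] using this

/-- Both the frequencies of a block and their differences are nonzero with coordinates at most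
2^(m_j + 1), so one Diophantine bound keeps the ⟨h,α⟩ away from 0 and from each other modulo 1. -/
lemma sum_block_le {α : Fin r → ℝ} {σ c : ℝ} (hc : 0 < c) (hc1 : c ≤ 1) (hσ : 0 ≤ σ)
    (hα : ∀ h : Fin r → ℤ, h ≠ 0 → c ≤ weight h ^ σ * distInt (∑ i, h i * α i)) (m : Fin r → ℕ)
    (B : Finset (Fin r → ℤ)) (hB : ∀ h ∈ B, h ≠ 0 ∧ binaryLength h = m) :
    ∑ h ∈ B, (weight h)⁻¹ * (distInt (∑ j, h j * α j))⁻¹ ≤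
      2 ^ r * (2 ^ (∑ j, m j))⁻¹ * (2 * ((2 ^ (∑ j, m j + r)) ^ σ / c *
        (1 + Real.log ((2 ^ (∑ j, m j + r)) ^ σ / c)))) := by
  set s := ∑ j, m j with hs
  set R : ℝ := 2 ^ (s + r) with hR
  have hR1 : 1 ≤ R := one_le_pow₀ one_le_two
  have hRσ : 1 ≤ R ^ σ := Real.one_le_rpow hR1 hσ
  have low : ∀ g : Fin r → ℤ, g ≠ 0 → (∀ j, |(g j : ℝ)| ≤ 2 ^ (m j + 1)) →
      c / R ^ σ ≤ distInt (∑ i, g i * α i) := by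
    intro g hg hgm
    rw [div_le_iff₀ (by positivity)]
    refine (hα g hg).trans ?_
    rw [mul_comm]
    refine mul_le_mul_of_nonneg_left ?_ (abs_nonneg _)
    exact Real.rpow_le_rpow (weight_pos g).le (weight_le_of_abs_le g m hgm) hσ
  have hlt : ∀ h ∈ B, ∀ j, |(h j : ℝ)| < 2 ^ m j := fun h hh j => by
    rw [← (hB h hh).2]
    exact abs_lt_two_pow_binaryLength h j
  have hmain := sum_inv_distInt_le B (fun h => ∑ j, (h j : ℝ) * α j) (δ := c / R ^ σ)
    (by positivity) (by rw [div_le_one (by positivity)]; linarith)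
    (fun h hh => low h (hB h hh).1 fun j => (hlt h hh j).le.trans
      (pow_le_pow_right₀ one_le_two (Nat.le_succ _)))
    (fun h hh h' hh' hne => by
      have := low (h - h') (sub_ne_zero.2 hne) (fun j => by
        rw [Pi.sub_apply, Int.cast_sub, pow_succ]
        refine (abs_sub _ _).trans ?_
        have := hlt h hh j
        have := hlt h' hh' j
        linarith)
      convert this using 2
      rw [← Finset.sum_sub_distrib]
      refine Finset.sum_congr rfl fun j _ => ?_
      push_cast [Pi.sub_apply]
      ring)
  rw [inv_div] at hmain
  have hw : ∀ h ∈ B, (weight h)⁻¹ ≤ 2 ^ r * (2 ^ s)⁻¹ := fun h hh => by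
    have h1 := two_pow_sum_binaryLength_le h
    rw [(hB h hh).2] at h1
    rw [← div_eq_mul_inv, inv_eq_one_div, div_le_div_iff₀ (weight_pos h) (by positivity), one_mul]
    exact h1
  calc ∑ h ∈ B, (weight h)⁻¹ * (distInt (∑ j, h j * α j))⁻¹
      ≤ ∑ h ∈ B, 2 ^ r * (2 ^ s)⁻¹ * (distInt (∑ j, h j * α j))⁻¹ :=
        Finset.sum_le_sum fun h hh => mul_le_mul_of_nonneg_right (hw h hh)
          (inv_nonneg.2 (abs_nonneg _))
    _ ≤ _ := by
        rw [← Finset.mul_sum]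
        exact mul_le_mul_of_nonneg_left hmain (by positivity)

theorem exists_smallDivisorSum_le {α : Fin r → ℝ} {σ : ℝ} (hσ : 0 ≤ σ)
    (hα : DiophantineWith α σ) : ∃ C : ℝ, 0 < C ∧ ∀ H : ℕ, smallDivisorSum α H ≤
      C * (∑ t ∈ Finset.range (H.size + 1), ((2 : ℝ) ^ (σ - 1)) ^ t) ^ r * (1 + H.size) := by
  obtain ⟨c₀, hc₀, hα₀⟩ := hα
  -- Having c ≤ 1 keeps the separation at most 1 and log(1/c) nonnegative.
  set c := min c₀ 1 with hcdef
  have hc : 0 < c := lt_min hc₀ one_pos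
  have hc1 : c ≤ 1 := min_le_right _ _
  have hαc : ∀ h : Fin r → ℤ, h ≠ 0 → c ≤ weight h ^ σ * distInt (∑ i, h i * α i) :=
    fun h hh => (min_le_left _ _).trans (hα₀ h hh)
  have hlogc : 0 ≤ Real.log c⁻¹ := Real.log_nonneg ((one_le_inv₀ hc).2 hc1)
  set K : ℝ := 1 + Real.log c⁻¹ + 2 * σ * r with hK
  have hK0 : 0 < K := by positivity
  refine ⟨2 ^ r * 2 * (2 ^ r) ^ σ * c⁻¹ * K, by positivity, fun H => ?_⟩
  set L := H.size with hL
  set q : ℝ := 2 ^ (σ - 1) with hq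
  have hmaps : ∀ h ∈ frequencies r H,
      binaryLength h ∈ Fintype.piFinset fun _ : Fin r => Finset.range (L + 1) := by
    intro h hh
    rw [Fintype.mem_piFinset]
    intro j
    have := Fintype.mem_piFinset.1 (Finset.mem_of_mem_erase hh) j
    rw [Finset.mem_Ioo] at this
    rw [Finset.mem_range, Nat.lt_succ_iff]
    exact Nat.size_le_size (by omega)
  rw [smallDivisorSum, ← Finset.sum_fiberwise_of_maps_to hmaps]
  have hblock : ∀ m ∈ Fintype.piFinset fun _ : Fin r => Finset.range (L + 1),
      ∑ h ∈ (frequencies r H).filter (fun h => binaryLength h = m),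
        (weight h)⁻¹ * (distInt (∑ j, h j * α j))⁻¹ ≤
      2 ^ r * 2 * (2 ^ r) ^ σ * c⁻¹ * K * (1 + L) * ∏ j, q ^ m j := by
    intro m hm
    refine (sum_block_le hc hc1 hσ hαc m _ fun h hh => ?_).trans ?_
    · rw [Finset.mem_filter] at hh
      exact ⟨Finset.ne_of_mem_erase hh.1, hh.2⟩
    · have hsL : ((∑ j, m j : ℕ) : ℝ) ≤ r * L := by
        have : ∑ j, m j ≤ ∑ _j : Fin r, L := Finset.sum_le_sum fun j _ =>
          Nat.lt_succ_iff.1 (Finset.mem_range.1 (Fintype.mem_piFinset.1 hm j))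
        rw [Finset.sum_const, Finset.card_univ, Fintype.card_fin, smul_eq_mul] at this
        exact_mod_cast this
      rw [Finset.prod_pow_eq_pow_sum]
      set s := ∑ j, m j with hs
      have hpow : ((2 : ℝ) ^ (s + r)) ^ σ = (2 ^ s) * q ^ s * (2 ^ r) ^ σ := by
        rw [pow_add, Real.mul_rpow (by positivity) (by positivity)]
        congr 1
        have h2 : (2 : ℝ) * 2 ^ (σ - 1) = 2 ^ σ := by
          rw [Real.rpow_sub_one two_ne_zero]
          ring
        rw [← mul_pow, hq, h2, ← Real.rpow_natCast, ← Real.rpow_natCast, ← Real.rpow_mul (by norm_num),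
          ← Real.rpow_mul (by norm_num), mul_comm]
      have hlog : 1 + Real.log ((2 ^ (s + r)) ^ σ / c) ≤ K * (1 + L) := by
        rw [div_eq_mul_inv, Real.log_mul (by positivity) (by positivity),
          Real.log_rpow (by positivity), Real.log_pow]
        have hl2 : Real.log 2 ≤ 1 := by linarith [Real.log_two_lt_d9]
        have hl0 : 0 ≤ Real.log 2 := Real.log_nonneg one_le_two
        have h1 : ((s + r : ℕ) : ℝ) * Real.log 2 ≤ r * (1 + L) := by
          push_cast
          nlinarith [Nat.cast_nonneg (α := ℝ) s, Nat.cast_nonneg (α := ℝ) r]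
        have h2 : σ * (((s + r : ℕ) : ℝ) * Real.log 2) ≤ σ * (r * (1 + L)) :=
          mul_le_mul_of_nonneg_left h1 hσ
        have h3 : (0 : ℝ) ≤ L := Nat.cast_nonneg L
        have h4 : 0 ≤ σ * r * (1 + L) := by positivity
        rw [hK]
        nlinarith [mul_nonneg hlogc h3]
      calc 2 ^ r * (2 ^ s)⁻¹ * (2 * ((2 ^ (s + r)) ^ σ / c *
            (1 + Real.log ((2 ^ (s + r)) ^ σ / c))))
          ≤ 2 ^ r * (2 ^ s)⁻¹ * (2 * ((2 ^ (s + r)) ^ σ / c * (K * (1 + L)))) := by gcongr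
        _ = _ := by
          rw [hpow]
          field_simp
  -- The block bounds factor over coordinates, so their sum is the r-th power of one geometric sum.
  refine (Finset.sum_le_sum hblock).trans (le_of_eq ?_)
  rw [← Finset.mul_sum, Finset.sum_pow']
  ring

lemma DiophantineWith.mono {α : Fin r → ℝ} {σ τ : ℝ} (h : DiophantineWith α σ) (hστ : σ ≤ τ) :
    DiophantineWith α τ := by
  obtain ⟨c, hc, H⟩ := h
  refine ⟨c, hc, fun h hh => (H h hh).trans ?_⟩
  exact mul_le_mul_of_nonneg_right (Real.rpow_le_rpow_of_exponent_le (one_le_weight h) hστ)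
    (abs_nonneg _)

/-- Dirichlet approximation of the first coordinate alone gives frequencies k ≤ n with ‖kα‖ ≤ 1/n,
which rules out exponents below 1. -/
lemma DiophantineWith.one_le (hr : 1 ≤ r) {α : Fin r → ℝ} {σ : ℝ} (h : DiophantineWith α σ) :
    1 ≤ σ := by
  by_contra! hσ
  -- A nonnegative exponent is needed to replace k by n in k^τ.
  obtain ⟨c, hc, H⟩ := h.mono (le_max_left σ 0)
  set τ := max σ 0 with hτ
  have hτ0 : 0 ≤ τ := le_max_right _ _
  have hτ1 : τ < 1 := max_lt hσ one_pos
  have key : ∀ n : ℕ, 0 < n → c ≤ (n : ℝ) ^ (-(1 - τ)) := by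
    intro n hn
    have hn' : (0 : ℝ) < n := by exact_mod_cast hn
    set i : Fin r := ⟨0, hr⟩
    obtain ⟨j, k, hk, hkn, hjk⟩ := Real.exists_int_int_abs_mul_sub_le (α i) hn
    have hk' : (1 : ℝ) ≤ k := by exact_mod_cast hk
    have hkn' : (k : ℝ) ≤ n := by exact_mod_cast hkn
    have h1 := H (Pi.single i k) (by simp [hk.ne'])
    have hw : weight (Pi.single i k : Fin r → ℤ) = k := by
      rw [weight, Finset.prod_eq_single i]
      · rw [Pi.single_eq_same, abs_of_nonneg (by linarith), max_eq_right hk']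
      · intro b _ hb
        simp [hb]
      · simp
    have hsum : ∑ l, ((Pi.single i k : Fin r → ℤ) l : ℝ) * α l = k * α i := by
      rw [Finset.sum_eq_single i]
      · simp
      · intro b _ hb
        simp [hb]
      · simp
    rw [hw, hsum] at h1
    have h2 : distInt (k * α i) ≤ (n : ℝ)⁻¹ := by
      refine (distInt_le_abs_sub_int _ j).trans (hjk.trans ?_)
      rw [← one_div]
      gcongr
      linarith
    calc c ≤ (k : ℝ) ^ τ * distInt (k * α i) := h1
      _ ≤ (n : ℝ) ^ τ * (n : ℝ)⁻¹ := by
          gcongr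
          exact abs_nonneg _
      _ = (n : ℝ) ^ (-(1 - τ)) := by
          rw [neg_sub, Real.rpow_sub_one hn'.ne', div_eq_mul_inv]
  have hlim : Tendsto (fun n : ℕ => (n : ℝ) ^ (-(1 - τ))) atTop (nhds 0) :=
    (tendsto_rpow_neg_atTop (by linarith)).comp tendsto_natCast_atTop_atTop
  have := ge_of_tendsto hlim (eventually_atTop.2 ⟨1, fun n hn => key n hn⟩)
  linarith

end SmallDivisors

/-! ### Choice of the cutoff and the rates -/

section Rates

variable {r : ℕ}

/-- The discrepancy of the orbits of length `n`, over all boxes of the torus. -/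
def boxDiscrepancy (α : Fin r → ℝ) (n : ℕ) : ℝ :=
  sSup {x | ∃ a l : Fin r → ℝ, (∀ j, 0 ≤ l j ∧ l j ≤ 1) ∧ x = |boxDeviation α n a l|}

lemma abs_boxDeviation_le_boxDiscrepancy (α : Fin r → ℝ) (n : ℕ) (a l : Fin r → ℝ)
    (hl : ∀ j, 0 ≤ l j ∧ l j ≤ 1) : |boxDeviation α n a l| ≤ boxDiscrepancy α n := by
  refine le_csSup ⟨n, ?_⟩ ⟨a, l, hl, rfl⟩
  rintro x ⟨a, l, hl, rfl⟩
  exact abs_boxDeviation_le α n a l hl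

lemma boxDiscrepancy_nonneg (α : Fin r → ℝ) (n : ℕ) : 0 ≤ boxDiscrepancy α n :=
  (abs_nonneg _).trans (abs_boxDeviation_le_boxDiscrepancy α n 0 0 fun _ => by simp)

lemma boxDiscrepancy_le (hr : 1 ≤ r) {H : ℕ} (hH : 0 < H) {α : Fin r → ℝ} {σ : ℝ}
    (hα : DiophantineWith α σ) (n : ℕ) :
    boxDiscrepancy α n ≤ 2 * smallDivisorSum α H + 8 * r ^ 2 * (n / H) := by
  refine csSup_le ⟨_, 0, 0, fun _ => by simp, rfl⟩ ?_
  rintro x ⟨a, l, hl, rfl⟩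
  exact abs_boxDeviation_le_smallDivisorSum hr hH hα n a l hl

/-- With H fixed, the small divisor sum is constant and disappears after division by M; what remains
is 8r²/H, made small by the choice of H. -/
lemma tendsto_boxDiscrepancy_div (hr : 1 ≤ r) {α : Fin r → ℝ} {σ : ℝ}
    (hα : DiophantineWith α σ) :
    Tendsto (fun M : ℕ => boxDiscrepancy α M / M) atTop (nhds 0) := by
  refine tendsto_order.2 ⟨fun a ha => Eventually.of_forall fun M =>
    ha.trans_le (div_nonneg (boxDiscrepancy_nonneg α M) (Nat.cast_nonneg M)), fun ε hε => ?_⟩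
  obtain ⟨H, hH⟩ := exists_nat_gt (8 * (r : ℝ) ^ 2 / (ε / 2))
  have hH0 : (0 : ℝ) < H := lt_of_le_of_lt (by positivity) hH
  have hlim : Tendsto (fun M : ℕ => 2 * smallDivisorSum α H / (M : ℝ)) atTop (nhds 0) :=
    tendsto_const_nhds.div_atTop tendsto_natCast_atTop_atTop
  filter_upwards [hlim.eventually (gt_mem_nhds (half_pos hε)), eventually_gt_atTop 0] with M hM hM0
  have hM' : (0 : ℝ) < M := by exact_mod_cast hM0
  have h1 := boxDiscrepancy_le hr (Nat.cast_pos.1 hH0) hα M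
  have h2 : 8 * (r : ℝ) ^ 2 / H < ε / 2 := by
    rw [div_lt_iff₀ (half_pos hε)] at hH
    rw [div_lt_iff₀ hH0]
    linarith
  calc boxDiscrepancy α M / M ≤ (2 * smallDivisorSum α H + 8 * r ^ 2 * (M / H)) / M := by gcongr
    _ = 2 * smallDivisorSum α H / M + 8 * r ^ 2 / H := by field_simp
    _ < ε := by linarith

lemma abs_birkhoffDeviation_le_boxDiscrepancy (hr : 1 ≤ r) {f : (Fin r → ℝ) → ℝ}
    (hf : IsBVHardyKrause f) {α : Fin r → ℝ} {σ : ℝ} (hα : DiophantineWith α σ) (n : ℕ)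
    (x : UnitAddTorus (Fin r)) :
    |birkhoffDeviation f α n x| ≤ hardyKrauseVariation f * boxDiscrepancy α n :=
  abs_birkhoffDeviation_le f hf α _ (abs_boxDeviation_le_boxDiscrepancy α)
    (tendsto_boxDiscrepancy_div hr hα) n x

lemma abs_supDeviation_le (hr : 1 ≤ r) {f : (Fin r → ℝ) → ℝ}
    (hf : IsBVHardyKrause f) {α : Fin r → ℝ} {σ : ℝ} (hα : DiophantineWith α σ) (n : ℕ) :
    |supDeviation f α n| ≤ hardyKrauseVariation f * boxDiscrepancy α n := by
  rw [supDeviation, abs_of_nonneg (Real.iSup_nonneg fun _ => abs_nonneg _)]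
  exact ciSup_le fun x => abs_birkhoffDeviation_le_boxDiscrepancy hr hf hα n x

lemma supDeviation_isBigO (hr : 1 ≤ r) {f : (Fin r → ℝ) → ℝ}
    (hf : IsBVHardyKrause f) {α : Fin r → ℝ} {σ : ℝ} (hα : DiophantineWith α σ) (g : ℕ → ℝ) (K : ℝ)
    (h : ∀ n : ℕ, 3 ≤ n → boxDiscrepancy α n ≤ K * g n) :
    (fun n : ℕ => supDeviation f α n) =O[atTop] g := by
  have hV := hardyKrauseVariation_nonneg f
  refine Asymptotics.IsBigO.of_bound (hardyKrauseVariation f * |K|)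
    (eventually_atTop.2 ⟨3, fun n hn => ?_⟩)
  rw [Real.norm_eq_abs, Real.norm_eq_abs, mul_assoc, ← abs_mul]
  refine (abs_supDeviation_le hr hf hα n).trans ?_
  exact mul_le_mul_of_nonneg_left ((h n hn).trans (le_abs_self _)) hV

lemma two_pow_size_le {H : ℕ} (hH : 0 < H) : (2 : ℝ) ^ H.size ≤ 2 * H := by
  have hs : 0 < H.size := Nat.size_pos.2 hH
  have h1 : 2 ^ (H.size - 1) ≤ H := Nat.lt_size.1 (Nat.sub_lt hs one_pos)
  have h2 : (2 : ℝ) ^ (H.size - 1) ≤ H := by exact_mod_cast h1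
  calc (2 : ℝ) ^ H.size = 2 * 2 ^ (H.size - 1) := by rw [← pow_succ', Nat.sub_add_cancel hs]
    _ ≤ 2 * H := by gcongr

lemma size_le_log {H : ℕ} (hH : 0 < H) : 1 + (H.size : ℝ) ≤ 2 + 2 * Real.log H := by
  have hH' : (0 : ℝ) < H := by exact_mod_cast hH
  have h := Real.log_le_log (by positivity) (two_pow_size_le hH)
  rw [Real.log_pow, Real.log_mul two_ne_zero hH'.ne'] at h
  have h2 := Real.log_two_gt_d9
  have h3 : 0 ≤ Real.log H := Real.log_nonneg (by exact_mod_cast hH)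
  by_contra! hc
  nlinarith

lemma one_le_log {n : ℕ} (hn : 3 ≤ n) : 1 ≤ Real.log n := by
  rw [Real.le_log_iff_exp_le (by positivity)]
  have : (3 : ℝ) ≤ n := by exact_mod_cast hn
  linarith [Real.exp_one_lt_d9]

theorem exists_boxDiscrepancy_le_of_one (hr : 1 ≤ r) {α : Fin r → ℝ} (hα : DiophantineWith α 1) :
    ∃ K : ℝ, ∀ n : ℕ, 3 ≤ n → boxDiscrepancy α n ≤ K * Real.log n ^ (r + 1) := by
  obtain ⟨C, hC, h⟩ := exists_smallDivisorSum_le zero_le_one hα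
  refine ⟨2 * (C * 4 ^ (r + 1)) + 8 * r ^ 2, fun n hn => ?_⟩
  have hn0 : 0 < n := by omega
  have hn' : (n : ℝ) ≠ 0 := by exact_mod_cast hn0.ne'
  have hlog := one_le_log hn
  -- The cutoff H = n makes the error n/H equal to 1, while every term of the geometric sum is 1.
  have h1 := boxDiscrepancy_le hr hn0 hα n
  have h2 := h n
  simp only [sub_self, Real.rpow_zero, one_pow, Finset.sum_const, Finset.card_range, nsmul_eq_mul,
    mul_one] at h2
  push_cast at h2
  have h3 : smallDivisorSum α n ≤ C * (4 * Real.log n) ^ (r + 1) := by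
    refine h2.trans ?_
    rw [mul_assoc, add_comm (n.size : ℝ) 1, ← pow_succ]
    gcongr
    linarith [size_le_log hn0]
  have h4 : 1 ≤ Real.log n ^ (r + 1) := one_le_pow₀ hlog
  rw [mul_pow] at h3
  rw [div_self hn', mul_one] at h1
  have h5 : 8 * (r : ℝ) ^ 2 ≤ 8 * r ^ 2 * Real.log n ^ (r + 1) :=
    le_mul_of_one_le_right (by positivity) h4
  linarith

theorem exists_boxDiscrepancy_le_of_one_lt (hr : 1 ≤ r) {α : Fin r → ℝ} {σ : ℝ} (hσ : 1 < σ)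
    (hα : DiophantineWith α σ) :
    ∃ K : ℝ, ∀ n : ℕ, 3 ≤ n → boxDiscrepancy α n ≤
      K * ((n : ℝ) ^ (1 - 1 / ((σ - 1) * (r : ℝ) + 1)) * Real.log n) := by
  obtain ⟨C, hC, h⟩ := exists_smallDivisorSum_le (by linarith) hα
  set q : ℝ := 2 ^ (σ - 1) with hq
  have hq1 : 1 < q := Real.one_lt_rpow one_lt_two (by linarith)
  have hσ0 : 0 < σ - 1 := by linarith
  -- This exponent balances H^((σ−1)r) against n/H for H ≈ n^β.
  set β : ℝ := 1 / ((σ - 1) * r + 1) with hβ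
  have hden : 1 ≤ (σ - 1) * r + 1 := by
    have : (0 : ℝ) ≤ r := Nat.cast_nonneg r
    nlinarith
  have hβ0 : 0 < β := by positivity
  have hβ1 : β ≤ 1 := (div_le_one (by linarith)).2 hden
  have hβe : β * ((σ - 1) * r) = 1 - β := by
    rw [hβ]
    field_simp
    ring
  set Q : ℝ := q / (q - 1) * 4 ^ (σ - 1) with hQ
  have hQ0 : 0 < Q := mul_pos (div_pos (by linarith) (by linarith)) (by positivity)
  refine ⟨2 * (C * Q ^ r * 6) + 8 * r ^ 2, fun n hn => ?_⟩
  have hn1 : (1 : ℝ) ≤ n := by exact_mod_cast (by omega : 1 ≤ n)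
  have hn0 : (0 : ℝ) < n := by linarith
  have hlog := one_le_log hn
  set x : ℝ := (n : ℝ) ^ β with hx
  have hx1 : 1 ≤ x := Real.one_le_rpow hn1 hβ0.le
  set H : ℕ := ⌈x⌉₊ with hHdef
  have hxH : x ≤ H := Nat.le_ceil x
  have hHx : (H : ℝ) ≤ 2 * x := by
    have := Nat.ceil_lt_add_one (by linarith : 0 ≤ x)
    linarith
  have hH0 : 0 < H := Nat.ceil_pos.2 (by linarith)
  have hH0' : (0 : ℝ) < H := by exact_mod_cast hH0
  have hgeom : ∑ t ∈ Finset.range (H.size + 1), q ^ t ≤ Q * x ^ (σ - 1) := by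
    have hqL : q ^ H.size ≤ 4 ^ (σ - 1) * x ^ (σ - 1) := by
      rw [← Real.mul_rpow (by norm_num) (by linarith), hq, ← Real.rpow_mul_natCast (by norm_num),
        mul_comm, Real.rpow_natCast_mul (by norm_num)]
      refine Real.rpow_le_rpow (by positivity) ?_ hσ0.le
      linarith [two_pow_size_le hH0]
    have hq1' : 0 < q - 1 := by linarith
    calc ∑ t ∈ Finset.range (H.size + 1), q ^ t = (q ^ (H.size + 1) - 1) / (q - 1) :=
          geom_sum_eq hq1.ne' _
      _ ≤ q ^ (H.size + 1) / (q - 1) := by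
          gcongr
          linarith
      _ = q / (q - 1) * q ^ H.size := by
          rw [pow_succ]
          ring
      _ ≤ q / (q - 1) * (4 ^ (σ - 1) * x ^ (σ - 1)) := by gcongr
      _ = Q * x ^ (σ - 1) := by rw [hQ, mul_assoc]
  have hxr : (x ^ (σ - 1)) ^ r = (n : ℝ) ^ (1 - β) := by
    rw [← Real.rpow_mul_natCast (by linarith), hx, ← Real.rpow_mul hn0.le, hβe]
  have hsize : 1 + (H.size : ℝ) ≤ 6 * Real.log n := by
    have h1 : Real.log H ≤ 2 * Real.log n := by
      calc Real.log H ≤ Real.log (2 * x) := Real.log_le_log hH0' hHx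
        _ = Real.log 2 + β * Real.log n := by
            rw [Real.log_mul two_ne_zero (by linarith), hx, Real.log_rpow hn0]
        _ ≤ 2 * Real.log n := by
            have := Real.log_two_lt_d9
            nlinarith
    linarith [size_le_log hH0]
  have hS : smallDivisorSum α H ≤ C * Q ^ r * 6 * ((n : ℝ) ^ (1 - β) * Real.log n) := by
    calc smallDivisorSum α H
        ≤ C * (∑ t ∈ Finset.range (H.size + 1), q ^ t) ^ r * (1 + H.size) := h H
      _ ≤ C * (Q * x ^ (σ - 1)) ^ r * (6 * Real.log n) := by
          gcongr
      _ = C * Q ^ r * 6 * ((n : ℝ) ^ (1 - β) * Real.log n) := by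
          rw [mul_pow, hxr]
          ring
  have hR : (n : ℝ) / H ≤ (n : ℝ) ^ (1 - β) * Real.log n := by
    calc (n : ℝ) / H ≤ n / x := by gcongr
      _ = (n : ℝ) ^ (1 - β) := by rw [hx, Real.rpow_sub hn0, Real.rpow_one]
      _ ≤ (n : ℝ) ^ (1 - β) * Real.log n := le_mul_of_one_le_right (by positivity) hlog
  have h1 := boxDiscrepancy_le hr hH0 hα n
  have h5 := mul_le_mul_of_nonneg_left hR (by positivity : (0 : ℝ) ≤ 8 * r ^ 2)
  linarith

end Rates

end TorusRotation

end

/-! ### The proposition -/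

theorem mainTheorem9 (r : ℕ) (hr : 1 ≤ r) (f : (Fin r → ℝ) → ℝ)
    (hf : TorusRotation.IsBVHardyKrause f) (α : Fin r → ℝ) (η : ℝ)
    (hα : TorusRotation.IsOfType α η) :
    -- the integral and the suprema in the claim are genuine
    Integrable (TorusRotation.onTorus f) (volume : Measure (UnitAddTorus (Fin r))) ∧
    (∀ n : ℕ, BddAbove (Set.range fun x : UnitAddTorus (Fin r) =>
      |TorusRotation.birkhoffDeviation f α n x|)) ∧
    -- the rates at the type itself, when the infimum defining it is attained
    (TorusRotation.DiophantineWith α η →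
      (η = 1 → (fun n : ℕ => TorusRotation.supDeviation f α n) =O[atTop]
        fun n : ℕ => Real.log (n : ℝ) ^ (r + 1)) ∧
      (1 < η → (fun n : ℕ => TorusRotation.supDeviation f α n) =O[atTop]
        fun n : ℕ => (n : ℝ) ^ (1 - 1 / ((η - 1) * (r : ℝ) + 1)) * Real.log (n : ℝ))) ∧
    -- the rates at every larger exponent, in all cases
    (∀ η' : ℝ, η < η' → (fun n : ℕ => TorusRotation.supDeviation f α n) =O[atTop]
      fun n : ℕ => (n : ℝ) ^ (1 - 1 / ((η' - 1) * (r : ℝ) + 1)) * Real.log (n : ℝ)) := by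
  have hη : 1 ≤ η := hα.2.2 fun σ hσ => TorusRotation.DiophantineWith.one_le hr hσ
  have hD : ∀ η' : ℝ, η < η' → TorusRotation.DiophantineWith α η' := by
    intro η' h
    obtain ⟨σ, hσ, -, hση⟩ := hα.2.exists_between h
    exact TorusRotation.DiophantineWith.mono hσ hση.le
  have rate : ∀ σ : ℝ, 1 < σ → TorusRotation.DiophantineWith α σ →
      (fun n : ℕ => TorusRotation.supDeviation f α n) =O[atTop]
        fun n : ℕ => (n : ℝ) ^ (1 - 1 / ((σ - 1) * (r : ℝ) + 1)) * Real.log (n : ℝ) := by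
    intro σ hσ h
    obtain ⟨K, hK⟩ := TorusRotation.exists_boxDiscrepancy_le_of_one_lt hr hσ h
    exact TorusRotation.supDeviation_isBigO hr hf h _ K hK
  refine ⟨TorusRotation.integrable_onTorus f hf, fun n => ?_, fun h => ⟨?_, fun h1 => rate η h1 h⟩,
    fun η' h => rate η' (hη.trans_lt h) (hD η' h)⟩
  · refine ⟨TorusRotation.hardyKrauseVariation f * TorusRotation.boxDiscrepancy α n,
      Set.forall_mem_range.2 fun x => ?_⟩
    exact TorusRotation.abs_birkhoffDeviation_le_boxDiscrepancy hr hf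
      -- Finiteness for each n needs only some admissible exponent; η + 1 is one even if the infimum
      -- is not attained.
      (hD (η + 1) (lt_add_one η)) n x
  · rintro rfl
    obtain ⟨K, hK⟩ := TorusRotation.exists_boxDiscrepancy_le_of_one hr h
    exact TorusRotation.supDeviation_isBigO hr hf h _ K hK
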